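/- Let $\mathfrak g$ be a finite-dimensional complex semisimple Lie algebra with a fixed Cartan subalgebra $\mathfrak h$ and a fixed system of positive roots, and let $V$ be a finite-dimensional irreducible representation of $\mathfrak g$. For finite-dimensional irreducible representations $M,N$ with highest weight vectors $m_+,n_+$, let $M\circledcirc N=\mathcal U(\mathfrak g)\cdot(m_+\otimes n_+)\subset M\otimes N$ denote their Cartan product, and let $\circledcirc^kV=\mathcal U(\mathfrak g)\cdot v_+^{\otimes k}\subset\otimes^kV$ for $k\ge 1$, where $v_+$ is a highest weight vector of $V$. Such a Cartan product or power is called well defined if it is irreducible and has a complementary subrepresentation in $M\otimes N$, respectively in $\otimes^kV$. Then for all integers $p,q,r>0$ the Cartan powers $\circledcirc^pV$ and the Cartan products $(\circledcirc^pV)\circledcirc(\circledcirc^qV)\subset \circledcirc^pV\otimes\circledcirc^qV$ are well defined, and, as subspaces of $\otimes^{p+q+r}V$, $$\left[\left((\circledcirc^pV)\circledcirc(\circledcirc^qV)\right)\otimes\circledcirc^rV\right]\cap\left[\circledcirc^pV\otimes\left((\circledcirc^qV)\circledcirc(\circledcirc^rV)\right)\right]=\circledcirc^{p+q+r}V.$$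 -/

import Mathlib

open scoped TensorProduct
open LieAlgebra LieAlgebra.IsKilling

/-! ### Tensor powers of a Lie algebra representation -/

section TensorPowerAction

variable {R L V : Type*} [CommRing R] [LieRing L] [LieAlgebra R L]
  [AddCommGroup V] [Module R V] [LieRingModule L V] [LieModule R L V] {n : ℕ}

/-- The action of `x : L` on the `i`-th tensor factor of `⨂[R]^n V`. -/
noncomputable def tensorPowerLieAt (x : L) (i : Fin n) :
    ⨂[R]^n V →ₗ[R] ⨂[R]^n V :=
  PiTensorProduct.map (Function.update (fun _ => LinearMap.id) i (LieModule.toEnd R L V x))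

theorem tensorPowerLieAt_tprod (x : L) (i : Fin n) (v : Fin n → V) :
    tensorPowerLieAt (R := R) x i (PiTensorProduct.tprod R v) =
      PiTensorProduct.tprod R (Function.update v i ⁅x, v i⁆) := by
  rw [tensorPowerLieAt, PiTensorProduct.map_tprod]
  congr 1
  funext j
  by_cases h : j = i
  · subst h; simp
  · simp [h]

/-- The action of `x : L` on `⨂[R]^n V` by the Leibniz rule. -/
noncomputable def tensorPowerLie (x : L) : ⨂[R]^n V →ₗ[R] ⨂[R]^n V :=
  ∑ i, tensorPowerLieAt x i

theorem tensorPowerLie_tprod (x : L) (v : Fin n → V) :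
    tensorPowerLie (R := R) x (PiTensorProduct.tprod R v) =
      ∑ i, PiTensorProduct.tprod R (Function.update v i ⁅x, v i⁆) := by
  simp [tensorPowerLie, LinearMap.sum_apply, tensorPowerLieAt_tprod]

theorem tensorPowerLie_add (x y : L) :
    tensorPowerLie (R := R) (V := V) (n := n) (x + y) = tensorPowerLie x + tensorPowerLie y := by
  ext v
  simp [tensorPowerLie_tprod, Finset.sum_add_distrib]

theorem tensorPowerLie_smul (c : R) (x : L) :
    tensorPowerLie (R := R) (V := V) (n := n) (c • x) = c • tensorPowerLie x := by
  ext v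
  simp [tensorPowerLie_tprod, Finset.smul_sum]

theorem tensorPowerLie_lie (x y : L) (t : ⨂[R]^n V) :
    tensorPowerLie x (tensorPowerLie y t) =
      tensorPowerLie ⁅x, y⁆ t + tensorPowerLie y (tensorPowerLie x t) := by
  suffices h : tensorPowerLie (R := R) (V := V) (n := n) x ∘ₗ tensorPowerLie y =
      tensorPowerLie ⁅x, y⁆ + tensorPowerLie y ∘ₗ tensorPowerLie x from LinearMap.congr_fun h t
  ext v
  simp only [LinearMap.compMultilinearMap_apply, LinearMap.comp_apply, LinearMap.add_apply,
    tensorPowerLie_tprod, map_sum]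
  rw [Finset.sum_comm (f := fun i j => PiTensorProduct.tprod R
    (Function.update (Function.update v i ⁅x, v i⁆) j ⁅y, Function.update v i ⁅x, v i⁆ j⁆)),
    ← Finset.sum_add_distrib]
  refine Finset.sum_congr rfl fun i _ => ?_
  rw [← Finset.add_sum_erase Finset.univ _ (Finset.mem_univ i),
    ← Finset.add_sum_erase Finset.univ (fun j => PiTensorProduct.tprod R
      (Function.update (Function.update v j ⁅x, v j⁆) i ⁅y, Function.update v j ⁅x, v j⁆ i⁆))
      (Finset.mem_univ i), ← add_assoc]
  congr 1
  · simp only [Function.update_self, Function.update_idem]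
    rw [leibniz_lie x y, MultilinearMap.map_update_add]
  · refine Finset.sum_congr rfl fun j hj => ?_
    have hij : j ≠ i := Finset.ne_of_mem_erase hj
    rw [Function.update_of_ne hij, Function.update_of_ne hij.symm, Function.update_comm hij]

/-- The `n`-th tensor power of a representation of `L`, with
`⁅x, v₁ ⊗ ⋯ ⊗ vₙ⁆ = ∑ i, v₁ ⊗ ⋯ ⊗ ⁅x, vᵢ⁆ ⊗ ⋯ ⊗ vₙ`. -/
noncomputable instance tensorPowerLieRingModule : LieRingModule L (⨂[R]^n V) where
  bracket x t := tensorPowerLie x t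
  add_lie x y t := by
    change tensorPowerLie (x + y) t = tensorPowerLie x t + tensorPowerLie y t
    rw [tensorPowerLie_add]; rfl
  lie_add x s t := map_add (tensorPowerLie x) s t
  leibniz_lie x y t := tensorPowerLie_lie x y t

theorem tensorPower_lie_tprod (x : L) (v : Fin n → V) :
    ⁅x, (PiTensorProduct.tprod R v : ⨂[R]^n V)⁆ =
      ∑ i, PiTensorProduct.tprod R (Function.update v i ⁅x, v i⁆) :=
  tensorPowerLie_tprod x v

instance tensorPowerLieModule : LieModule R L (⨂[R]^n V) where
  smul_lie c x t := by
    change tensorPowerLie (c • x) t = c • tensorPowerLie x t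
    rw [tensorPowerLie_smul]; rfl
  lie_smul c x t := map_smul (tensorPowerLie x) c t

/-- The map `M ⊗ N → ⨂^m V ⊗ ⨂^n V ≅ ⨂^(m + n) V` induced by linear maps `M → ⨂^m V` and
`N → ⨂^n V`, the isomorphism being the concatenation of tensors. -/
noncomputable def tensorConcat {M N : Type*} [AddCommGroup M] [Module R M]
    [AddCommGroup N] [Module R N] {m n : ℕ}
    (f : M →ₗ[R] ⨂[R]^m V) (g : N →ₗ[R] ⨂[R]^n V) : M ⊗[R] N →ₗ[R] ⨂[R]^(m + n) V :=
  TensorPower.mulEquiv.toLinearMap ∘ₗ TensorProduct.map f g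

end TensorPowerAction

/-! ### Highest weight vectors and Cartan products -/

section CartanProduct

variable {L : Type*} [LieRing L] [LieAlgebra ℂ L] [FiniteDimensional ℂ L] [IsKilling ℂ L]
  {H : LieSubalgebra ℂ L} [H.IsCartanSubalgebra] (b : (rootSystem H).Base)

/-- `v` is a highest weight vector, with respect to the Cartan subalgebra `H` and the system of
positive roots with base `b`: a nonzero weight vector killed by all positive root vectors. -/
structure IsHighestWeightVector {M : Type*} [AddCommGroup M] [Module ℂ M] [LieRingModule L M]
    (v : M) : Prop where
  ne_zero : v ≠ 0
  exists_weight : ∃ μ : Module.Dual ℂ H, ∀ h : H, ⁅(h : L), v⁆ = μ h • v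
  lie_eq_zero : ∀ α : H.root, b.IsPos α → ∀ x ∈ rootSpace H (α : LieModule.Weight ℂ H L),
    ⁅x, v⁆ = 0

/-- The Cartan product `M ⊚ N ⊆ M ⊗ N` of two irreducible representations: the subrepresentation
generated by the tensor product of the highest weight vectors. -/
noncomputable def cartanProduct (M N : Type*)
    [AddCommGroup M] [Module ℂ M] [LieRingModule L M] [LieModule ℂ L M]
    [AddCommGroup N] [Module ℂ N] [LieRingModule L N] [LieModule ℂ L N] :
    LieSubmodule ℂ L (M ⊗[ℂ] N) :=
  LieSubmodule.lieSpan ℂ L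
    {t | ∃ v w, IsHighestWeightVector b v ∧ IsHighestWeightVector b w ∧ t = v ⊗ₜ[ℂ] w}

/-- The Cartan power `⊚^k V ⊆ ⨂^k V` of an irreducible representation: the subrepresentation
generated by `v ⊗ ⋯ ⊗ v`, with `v` the highest weight vector of `V`. -/
noncomputable def cartanPower (V : Type*)
    [AddCommGroup V] [Module ℂ V] [LieRingModule L V] [LieModule ℂ L V] (k : ℕ) :
    LieSubmodule ℂ L (⨂[ℂ]^k V) :=
  LieSubmodule.lieSpan ℂ L
    {t | ∃ v : V, IsHighestWeightVector b v ∧ t = PiTensorProduct.tprod ℂ (fun _ : Fin k => v)}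

/-- A subrepresentation that is irreducible and has a complementary subrepresentation. The Cartan
product (or power) is called well defined when it has this property. -/
def IsIrreducibleSummand {M : Type*} [AddCommGroup M] [Module ℂ M] [LieRingModule L M]
    (S : LieSubmodule ℂ L M) : Prop :=
  LieModule.IsIrreducible ℂ L S ∧ ∃ W : LieSubmodule ℂ L M, IsCompl S W

variable (V : Type*) [AddCommGroup V] [Module ℂ V] [LieRingModule L V] [LieModule ℂ L V]

/-- The inclusion `⊚^k V → ⨂^k V`. -/
noncomputable def cartanPowerIncl (k : ℕ) : cartanPower b V k →ₗ[ℂ] ⨂[ℂ]^k V :=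
  (cartanPower b V k).incl

/-- The inclusion `(⊚^p V) ⊚ (⊚^q V) → (⊚^p V) ⊗ (⊚^q V) → ⨂^(p + q) V`. -/
noncomputable def cartanProductIncl (p q : ℕ) :
    cartanProduct b (cartanPower b V p) (cartanPower b V q) →ₗ[ℂ] ⨂[ℂ]^(p + q) V :=
  tensorConcat (cartanPowerIncl b V p) (cartanPowerIncl b V q) ∘ₗ
    (cartanProduct b (cartanPower b V p) (cartanPower b V q)).incl.toLinearMap

/-- `((⊚^p V) ⊚ (⊚^q V)) ⊗ ⊚^r V`, as a subspace of `⨂^(p + q + r) V`. -/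
noncomputable def leftCartanTensor (p q r : ℕ) : Submodule ℂ (⨂[ℂ]^(p + q + r) V) :=
  LinearMap.range (tensorConcat (cartanProductIncl b V p q) (cartanPowerIncl b V r))

/-- `(⊚^p V) ⊗ ((⊚^q V) ⊚ (⊚^r V))`, as a subspace of `⨂^(p + q + r) V`. -/
noncomputable def rightCartanTensor (p q r : ℕ) : Submodule ℂ (⨂[ℂ]^(p + q + r) V) :=
  LinearMap.range ((TensorPower.cast ℂ V (add_assoc p q r).symm).toLinearMap ∘ₗ
    tensorConcat (cartanPowerIncl b V p) (cartanProductIncl b V q r))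

end CartanProduct

/-! Let v be a highest weight vector of V and μ its weight. The proof rests on the Casimir operator.
On a highest weight vector of weight ν it acts by (ν,ν) + (ν,2ρ), where 2ρ is the sum of the
positive roots. This scalar separates a dominant μ from every dominant μ - β, with β ≠ 0 a sum of
simple roots (`eq_zero_of_casimirEigenvalue_add_eq`). So in a finite-dimensional module spanned by a
highest weight vector of weight μ and vectors of lower weight, the Casimir eigenspace belonging to μ
is exactly the submodule generated by that vector. This submodule is irreducible, and the Fitting
decomposition of the Casimir operator complements it, without appeal to complete reducibility
(`isIrreducibleSummand_lieSpan`).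

The tensor power ⨂^n V is such a module. On it the Casimir operator is the sum over i, j of
operators C_ij, with one leg of the Casimir element in slot i and the other in slot j. C_ii is a
scalar because V is irreducible. For i ≠ j, C_ij multiplies v ⊗ ⋯ ⊗ v by κ = (μ,μ), whatever n is.
As C_ij commutes with the Lie algebra, the Cartan power lies in the common κ-eigenspace. Conversely,
a common eigenvector has the Casimir eigenvalue of v ⊗ ⋯ ⊗ v, hence lies in the Cartan power
(`exists_mem_cartanPower_iff`). Concatenation identifies (⊚^p V) ⊚ (⊚^q V) with ⊚^(p+q) V
(`map_cartanProduct`), which settles the Cartan products.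

For t in the intersection, C_ij t = κ t whenever i ≠ j both lie in the first p+q slots or both in
the last q+r. What remains is one index among the first p and the other among the last r. Since t is
symmetric in its first p+q slots, exchanging the early index with a middle slot k (one exists as q >
0) fixes t and reduces the claim to a pair k, j inside the last q+r slots. -/

/-! ### Dual bases for the Killing form and the Casimir operator. -/

section Casimir

variable {L : Type*} [LieRing L] [LieAlgebra ℂ L] [FiniteDimensional ℂ L] [IsKilling ℂ L]
  (H : LieSubalgebra ℂ L) [H.IsCartanSubalgebra]

theorem exists_rootSpace_killingForm_eq_one (α : LieModule.Weight ℂ H L) :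
    ∃ p : L × L, p.1 ∈ rootSpace H α ∧ p.2 ∈ rootSpace H (-α : LieModule.Weight ℂ H L) ∧
      killingForm ℂ L p.1 p.2 = 1 := by
  obtain ⟨e, heα : e ∈ rootSpace H α, he₀ : e ≠ 0⟩ := α.exists_ne_zero
  obtain ⟨f, hfα, hf⟩ : ∃ f ∈ rootSpace H (-α), killingForm ℂ L e f ≠ 0 := by
    contrapose! he₀
    simpa using mem_ker_killingForm_of_mem_rootSpace_of_forall_rootSpace_neg ℂ L H heα he₀
  refine ⟨(e, (killingForm ℂ L e f)⁻¹ • f), heα, Submodule.smul_mem _ _ hfα, ?_⟩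
  simp [hf]

/-- A pair of vectors in the root spaces of `α` and `-α` that are dual for the Killing form. -/
noncomputable def rootPair (α : LieModule.Weight ℂ H L) : L × L :=
  (exists_rootSpace_killingForm_eq_one H α).choose

theorem rootPair_fst_mem (α : LieModule.Weight ℂ H L) : (rootPair H α).1 ∈ rootSpace H α :=
  (exists_rootSpace_killingForm_eq_one H α).choose_spec.1

theorem rootPair_snd_mem (α : LieModule.Weight ℂ H L) :
    (rootPair H α).2 ∈ rootSpace H (-α : LieModule.Weight ℂ H L) :=
  (exists_rootSpace_killingForm_eq_one H α).choose_spec.2.1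

theorem killingForm_rootPair (α : LieModule.Weight ℂ H L) :
    killingForm ℂ L (rootPair H α).1 (rootPair H α).2 = 1 :=
  (exists_rootSpace_killingForm_eq_one H α).choose_spec.2.2

/-- A basis of the Cartan subalgebra. -/
noncomputable def cartanBasis : Module.Basis (Fin (Module.finrank ℂ H)) ℂ H := Module.finBasis ℂ H

/-- The basis of the Cartan subalgebra dual to `cartanBasis` for the Killing form. -/
noncomputable def cartanDualBasis : Module.Basis (Fin (Module.finrank ℂ H)) ℂ H :=
  LinearMap.BilinForm.dualBasis (LieModule.traceForm ℂ H L)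
    (LieAlgebra.IsKilling.traceForm_cartan_nondegenerate ℂ L H) (cartanBasis H)

/-- The first components of a pair of bases of `L` dual for the Killing form. -/
noncomputable def killingLeft : Fin (Module.finrank ℂ H) ⊕ H.root → L :=
  Sum.elim (fun i => cartanBasis H i) (fun α => (rootPair H α.1).1)

/-- The second components of a pair of bases of `L` dual for the Killing form. -/
noncomputable def killingRight : Fin (Module.finrank ℂ H) ⊕ H.root → L :=
  Sum.elim (fun i => cartanDualBasis H i) (fun α => (rootPair H α.1).2)

theorem sum_traceForm_cartanDualBasis_smul (z : H) :
    ∑ i, LieModule.traceForm ℂ H L (cartanDualBasis H i) z • cartanBasis H i = z := by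
  apply (LinearMap.BilinForm.toDual _
    (LieAlgebra.IsKilling.traceForm_cartan_nondegenerate ℂ L H)).injective
  refine (cartanDualBasis H).ext fun j => ?_
  simp only [LinearMap.BilinForm.toDual_def, map_sum, map_smul, LinearMap.sum_apply,
    LinearMap.smul_apply, smul_eq_mul]
  rw [Finset.sum_eq_single j]
  · rw [LieModule.traceForm_comm ℂ H L (cartanBasis H j), cartanDualBasis,
      LinearMap.BilinForm.apply_dualBasis_left]
    simp [LieModule.traceForm_comm ℂ H L z]
  · intro i _ hij
    rw [LieModule.traceForm_comm ℂ H L (cartanBasis H i), cartanDualBasis,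
      LinearMap.BilinForm.apply_dualBasis_left, if_neg hij, mul_zero]
  · simp

/-- The Killing form pairs the root space of α only with that of -α. For z in a single root space,
therefore, just one block of the sum survives: the Cartan block, or the term of a one-dimensional
root space. -/
theorem sum_killingForm_killingRight_smul (z : L) :
    ∑ a, killingForm ℂ L (killingRight H a) z • killingLeft H a = z := by
  have hz : z ∈ ⨆ β, rootSpace H β := by simp [LieModule.iSup_genWeightSpace_eq_top ℂ H L]
  induction hz using LieSubmodule.iSup_induction' with
  | mem β y hy =>
    have h0 : ∀ h : H, (h : L) ∈ rootSpace H (0 : H → ℂ) := fun h => by simp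
    have hneg : ∀ α : LieModule.Weight ℂ H L, (rootPair H α).2 ∈ rootSpace H (-(α : H → ℂ)) :=
      fun α => rootPair_snd_mem H α
    simp only [Fintype.sum_sum_type, killingLeft, killingRight, Sum.elim_inl, Sum.elim_inr]
    by_cases hβ : β = 0
    · subst hβ
      have hyH : y ∈ H := by simpa using hy
      rw [Finset.sum_eq_zero (s := (Finset.univ : Finset H.root)), add_zero]
      · have := congrArg (Subtype.val) (sum_traceForm_cartanDualBasis_smul H ⟨y, hyH⟩)
        simpa using this
      · intro α _
        rw [killingForm_apply_eq_zero_of_mem_rootSpace_of_add_ne_zero ℂ L H (hneg α) hy, zero_smul]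
        intro h
        simp at h
    · rw [Finset.sum_eq_zero, zero_add]
      · by_cases hy0 : y = 0
        · simp [hy0]
        let βw : LieModule.Weight ℂ H L := ⟨β, fun h => hy0 (by simpa [h] using hy)⟩
        have hβw : βw.IsNonZero := hβ
        have hmem : βw ∈ H.root := by simpa using hβw
        rw [Finset.sum_eq_single ⟨βw, hmem⟩]
        · obtain ⟨c, hc⟩ := (finrank_eq_one_iff_of_nonzero'
            (⟨(rootPair H βw).1, rootPair_fst_mem H βw⟩ : rootSpace H βw) (by
              intro h
              have h1 := killingForm_rootPair H βw
              have h2 : (rootPair H βw).1 = 0 := congrArg Subtype.val h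
              simp [h2] at h1)).1 (finrank_rootSpace_eq_one βw hβw) ⟨y, hy⟩
          have hc' : c • (rootPair H βw).1 = y := congrArg Subtype.val hc
          have h1 := killingForm_rootPair H βw
          rw [LieModule.traceForm_comm] at h1
          rw [← hc', map_smul, h1, smul_eq_mul, mul_one]
        · intro α _ hα
          rw [killingForm_apply_eq_zero_of_mem_rootSpace_of_add_ne_zero ℂ L H (hneg α) hy, zero_smul]
          intro h
          apply hα
          apply Subtype.ext
          apply DFunLike.coe_injective
          exact (neg_add_eq_zero.1 h)
        · simp
      · intro i _
        rw [killingForm_apply_eq_zero_of_mem_rootSpace_of_add_ne_zero ℂ L H (h0 _) hy, zero_smul]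
        simpa using hβ
  | zero => simp
  | add x y _ _ hx hy =>
    simp only [map_add, add_smul, Finset.sum_add_distrib, hx, hy]

/-- By nondegeneracy it suffices to pair both sides with an arbitrary w, and then to expand w by the
previous formula. -/
theorem sum_killingForm_killingLeft_smul (z : L) :
    ∑ a, killingForm ℂ L (killingLeft H a) z • killingRight H a = z := by
  rw [← sub_eq_zero, ← Submodule.mem_bot ℂ, ← LieAlgebra.IsKilling.ker_killingForm_eq_bot ℂ L,
    LinearMap.mem_ker]
  ext w
  have h := congrArg (fun u => killingForm ℂ L u z) (sum_killingForm_killingRight_smul H w)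
  simp only [map_sum, map_smul, LinearMap.sum_apply, LinearMap.smul_apply, smul_eq_mul] at h
  simp only [map_sub, map_sum, map_smul, LinearMap.sub_apply, LinearMap.sum_apply,
    LinearMap.smul_apply, smul_eq_mul, LinearMap.zero_apply]
  rw [LieModule.traceForm_comm ℂ L L z, ← h, sub_eq_zero]
  exact Finset.sum_congr rfl fun _ _ => mul_comm _ _

/-- The element `∑ xₐ ⊗ yₐ` given by bases dual for the Killing form is invariant. -/
theorem sum_killing_lie_add_eq_zero {P : Type*} [AddCommGroup P] [Module ℂ P]
    (Φ : L →ₗ[ℂ] L →ₗ[ℂ] P) (z : L) :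
    ∑ a, (Φ ⁅z, killingLeft H a⁆ (killingRight H a) +
      Φ (killingLeft H a) ⁅z, killingRight H a⁆) = 0 := by
  have h1 : ∀ a, Φ ⁅z, killingLeft H a⁆ (killingRight H a) =
      ∑ c, killingForm ℂ L (killingRight H c) ⁅z, killingLeft H a⁆ •
        Φ (killingLeft H c) (killingRight H a) := fun a => by
    conv_lhs => rw [← sum_killingForm_killingRight_smul H ⁅z, killingLeft H a⁆]
    simp [LinearMap.sum_apply]
  have h2 : ∀ a, Φ (killingLeft H a) ⁅z, killingRight H a⁆ =
      ∑ c, killingForm ℂ L (killingLeft H c) ⁅z, killingRight H a⁆ •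
        Φ (killingLeft H a) (killingRight H c) := fun a => by
    conv_lhs => rw [← sum_killingForm_killingLeft_smul H ⁅z, killingRight H a⁆]
    simp
  rw [Finset.sum_add_distrib, Finset.sum_congr rfl fun a _ => h1 a,
    Finset.sum_congr rfl fun a _ => h2 a, Finset.sum_comm, ← Finset.sum_add_distrib]
  refine Finset.sum_eq_zero fun a _ => ?_
  rw [← Finset.sum_add_distrib]
  refine Finset.sum_eq_zero fun c _ => ?_
  rw [← add_smul]
  -- Invariance of the Killing form: ad z is skew, so its matrices in the two dual bases are
  -- negative transposes of each other.
  have : killingForm ℂ L (killingRight H a) ⁅z, killingLeft H c⁆ +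
      killingForm ℂ L (killingLeft H c) ⁅z, killingRight H a⁆ = 0 := by
    rw [LieModule.traceForm_comm ℂ L L (killingLeft H c), ← lie_skew z (killingRight H a), map_neg,
      LinearMap.neg_apply, LieModule.traceForm_apply_lie_apply, ← lie_skew, map_neg]
    simp
  rw [this, zero_smul]

variable (M : Type*) [AddCommGroup M] [Module ℂ M] [LieRingModule L M] [LieModule ℂ L M]

/-- The Casimir operator of a representation. -/
noncomputable def casimir : Module.End ℂ M :=
  ∑ a, LieModule.toEnd ℂ L M (killingLeft H a) * LieModule.toEnd ℂ L M (killingRight H a)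

variable {M}

theorem casimir_apply (m : M) :
    casimir H M m = ∑ a, ⁅killingLeft H a, ⁅killingRight H a, m⁆⁆ := by
  simp [casimir, LinearMap.sum_apply]

theorem casimir_lie (z : L) (m : M) : casimir H M ⁅z, m⁆ = ⁅z, casimir H M m⁆ := by
  let Φ : L →ₗ[ℂ] L →ₗ[ℂ] M :=
    LinearMap.mk₂ ℂ (fun x y => ⁅x, ⁅y, m⁆⁆) (by simp) (by simp) (by simp) (by simp)
  have h := sum_killing_lie_add_eq_zero H Φ z
  rw [casimir_apply, casimir_apply, lie_sum, eq_comm, ← sub_eq_zero, ← Finset.sum_sub_distrib, ← h]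
  refine Finset.sum_congr rfl fun a _ => ?_
  simp only [Φ, LinearMap.mk₂_apply]
  rw [leibniz_lie z (killingLeft H a), leibniz_lie z (killingRight H a) m, lie_add]
  abel

theorem map_casimir {N : Type*} [AddCommGroup N] [Module ℂ N] [LieRingModule L N] [LieModule ℂ L N]
    (f : M →ₗ⁅ℂ,L⁆ N) (m : M) : f (casimir H M m) = casimir H N (f m) := by
  simp [casimir_apply]

end Casimir

/-! ### The form on weights, and the separation of dominant weights by the Casimir eigenvalue. -/

section WeightForm

variable {L : Type*} [LieRing L] [LieAlgebra ℂ L] [FiniteDimensional ℂ L] [IsKilling ℂ L]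
  {H : LieSubalgebra ℂ L} [H.IsCartanSubalgebra] (b : (rootSystem H).Base)

/-- The bilinear form on the dual of the Cartan subalgebra induced by the Killing form. -/
noncomputable def weightForm (H : LieSubalgebra ℂ L) [H.IsCartanSubalgebra] :
    Module.Dual ℂ H →ₗ[ℂ] Module.Dual ℂ H →ₗ[ℂ] ℂ :=
  LinearMap.mk₂ ℂ (fun μ ν => μ ((cartanEquivDual H).symm ν))
    (by simp) (by simp) (by simp) (by simp)

theorem weightForm_apply (μ ν : Module.Dual ℂ H) :
    weightForm H μ ν = μ ((cartanEquivDual H).symm ν) := rfl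

theorem weightForm_comm (μ ν : Module.Dual ℂ H) : weightForm H μ ν = weightForm H ν μ := by
  obtain ⟨x, rfl⟩ := (cartanEquivDual H).surjective μ
  obtain ⟨y, rfl⟩ := (cartanEquivDual H).surjective ν
  simp only [weightForm_apply, LinearEquiv.symm_apply_apply, cartanEquivDual_apply_apply]
  exact LieModule.traceForm_comm ℂ H L x y

theorem weightForm_root_root_ne_zero (α : H.root) :
    weightForm H ((rootSystem H).root α) ((rootSystem H).root α) ≠ 0 :=
  root_apply_cartanEquivDual_symm_ne_zero (H.isNonZero_coe_root α)

theorem apply_coroot_eq_weightForm (μ : Module.Dual ℂ H) (α : H.root) :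
    μ (coroot α.1) = 2 * (weightForm H ((rootSystem H).root α) ((rootSystem H).root α))⁻¹ *
      weightForm H μ ((rootSystem H).root α) := by
  rw [coroot]
  simp [weightForm_apply, mul_assoc]

/-- The form is complex-valued, so positivity has to be extracted: the factor is (α,α)/2, and
4/(α,α) is the Killing square of the coroot, a sum of squares of the integers β(α^∨) over the roots
β. -/
theorem exists_weightForm_eq_mul_apply_coroot (α : H.root) :
    ∃ k : ℝ, 0 < k ∧ ∀ μ : Module.Dual ℂ H,
      weightForm H μ ((rootSystem H).root α) = k * μ (coroot α.1) := by
  set a := weightForm H ((rootSystem H).root α) ((rootSystem H).root α) with ha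
  have ha0 : a ≠ 0 := weightForm_root_root_ne_zero α
  have h1 : LieModule.traceForm ℂ H L (coroot α.1) (coroot α.1) = 4 * a⁻¹ := by
    rw [traceForm_coroot, root_apply_coroot (H.isNonZero_coe_root α)]
    change 2 • a⁻¹ • (2 : ℂ) = _
    simp; ring
  have h2 : ∃ n : ℕ, LieModule.traceForm ℂ H L (coroot α.1) (coroot α.1) = n := by
    have h := LinearMap.congr_fun₂ (restrict_killingForm_eq_sum (K := ℂ) (L := L) (H := H))
      (coroot α.1) (coroot α.1)
    rw [restrict_killingForm] at h
    rw [h]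
    simp only [LinearMap.sum_apply, LinearMap.smulRight_apply, LinearMap.smul_apply, smul_eq_mul]
    have h3 : ∀ β : LieModule.Weight ℂ H L, ∃ z : ℤ, β (coroot α.1) = z :=
      fun β => ⟨_, apply_coroot_eq_cast α.1 β⟩
    choose z hz using h3
    refine ⟨∑ β ∈ H.root, (z β).natAbs ^ 2, ?_⟩
    push_cast
    refine Finset.sum_congr rfl fun β _ => ?_
    have h4 : (((z β).natAbs : ℤ) : ℂ) ^ 2 = (z β : ℂ) ^ 2 := by
      exact_mod_cast congrArg (Int.cast : ℤ → ℂ) (Int.natAbs_sq (z β))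
    rw [Int.cast_natCast] at h4
    rw [h4, pow_two]
    exact congrArg₂ (· * ·) (hz β) (hz β)
  obtain ⟨n, hn⟩ := h2
  rw [h1] at hn
  have hn0 : n ≠ 0 := by
    rintro rfl
    simp [ha0] at hn
  have haval : a = 4 / n := by
    have : (n : ℂ) ≠ 0 := by exact_mod_cast hn0
    field_simp at hn ⊢
    rw [hn]
  refine ⟨2 / n, by positivity, fun μ => ?_⟩
  rw [apply_coroot_eq_weightForm, ← ha, haval]
  have : (n : ℂ) ≠ 0 := by exact_mod_cast hn0
  push_cast
  field_simp
  ring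

/-- The monoid generated by the simple roots. -/
def positiveCone : AddSubmonoid (Module.Dual ℂ H) :=
  AddSubmonoid.closure ((rootSystem H).root '' b.support)

/-- The sum of the positive roots. -/
noncomputable def sumPosRoots : Module.Dual ℂ H :=
  open scoped Classical in ∑ α : H.root with b.IsPos α, (rootSystem H).root α

variable {b}

theorem root_mem_positiveCone {α : H.root} (hα : b.IsPos α) :
    (rootSystem H).root α ∈ positiveCone b :=
  hα.induction_on_add (p := fun α => (rootSystem H).root α ∈ positiveCone b)
    (fun _ hi => AddSubmonoid.subset_closure ⟨_, hi, rfl⟩)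
    (fun _ j _ hk hi hj => hk ▸ add_mem hi (AddSubmonoid.subset_closure ⟨j, hj, rfl⟩))

theorem reflectionPerm_isPos_and_ne {α β : H.root} (hα : α ∈ b.support) (hβ : b.IsPos β)
    (hne : β ≠ α) : b.IsPos ((rootSystem H).reflectionPerm α β) ∧
      (rootSystem H).reflectionPerm α β ≠ α := by
  refine ⟨hβ.reflectionPerm hα hne, fun h => ?_⟩
  have h1 : β = (rootSystem H).reflectionPerm α α :=
    ((rootSystem H).reflectionPerm α).injective (by rw [h]; simp)
  have h2 := RootPairing.Base.height_reflectionPerm_self b α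
  have h3 := RootPairing.Base.isPos_of_mem_support hα
  rw [h1, RootPairing.Base.isPos_iff] at hβ
  rw [RootPairing.Base.isPos_iff] at h3
  change b.height ((rootSystem H).reflectionPerm α α) = _ at h2
  omega

/-- The simple reflection in α permutes the positive roots other than α. Their sum is thus fixed by
it and vanishes on the coroot, so that only α(α^∨) = 2 is left. -/
theorem sumPosRoots_apply_coroot {α : H.root} (hα : α ∈ b.support) :
    sumPosRoots b (coroot α.1) = 2 := by
  classical
  set S : Finset H.root := {β | b.IsPos β ∧ β ≠ α} with hS
  have hmem : ∀ β, β ∈ S ↔ b.IsPos β ∧ β ≠ α := fun β => by simp [hS]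
  have h1 : sumPosRoots b = (rootSystem H).root α + ∑ β ∈ S, (rootSystem H).root β := by
    rw [sumPosRoots, ← Finset.sum_insert (by simp [hmem])]
    refine Finset.sum_congr ?_ fun _ _ => rfl
    ext β
    rw [Finset.mem_insert, hmem, Finset.mem_filter]
    by_cases h : β = α
    · subst h
      simpa using RootPairing.Base.isPos_of_mem_support hα
    · simp [h]
  have h2 : (rootSystem H).reflection α (∑ β ∈ S, (rootSystem H).root β) =
      ∑ β ∈ S, (rootSystem H).root β := by
    rw [map_sum]
    refine Finset.sum_bij (fun β _ => (rootSystem H).reflectionPerm α β) (fun β hβ => ?_)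
      (fun x _ y _ h => ((rootSystem H).reflectionPerm α).injective h) (fun β hβ => ?_)
      (fun β _ => by rw [RootPairing.root_reflectionPerm])
    · rw [hmem] at hβ ⊢
      exact reflectionPerm_isPos_and_ne hα hβ.1 hβ.2
    · rw [hmem] at hβ
      exact ⟨_, (hmem _).2 (reflectionPerm_isPos_and_ne hα hβ.1 hβ.2), by simp⟩
  have h3 : (∑ β ∈ S, (rootSystem H).root β) (coroot α.1) = 0 := by
    rw [RootPairing.reflection_apply] at h2
    exact (smul_eq_zero.1 (sub_eq_self.1 h2)).resolve_right ((rootSystem H).ne_zero α)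
  rw [h1, LinearMap.add_apply, h3, add_zero]
  exact root_apply_coroot (H.isNonZero_coe_root α)

theorem weightForm_re_nonneg {μ β : Module.Dual ℂ H}
    (hμ : ∀ α : H.root, b.IsPos α → ∃ n : ℕ, μ (coroot α.1) = n) (hβ : β ∈ positiveCone b) :
    0 ≤ (weightForm H μ β).re := by
  induction hβ using AddSubmonoid.closure_induction with
  | mem β hβ =>
    obtain ⟨α, hα, rfl⟩ := hβ
    obtain ⟨k, hk, h⟩ := exists_weightForm_eq_mul_apply_coroot α
    obtain ⟨n, hn⟩ := hμ α (RootPairing.Base.isPos_of_mem_support hα)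
    rw [h, hn, Complex.re_ofReal_mul, Complex.natCast_re]
    positivity
  | zero => simp
  | add x y _ _ hx hy => rw [map_add, Complex.add_re]; positivity

theorem eq_zero_or_weightForm_sumPosRoots_re_pos {β : Module.Dual ℂ H}
    (hβ : β ∈ positiveCone b) : β = 0 ∨ 0 < (weightForm H (sumPosRoots b) β).re := by
  induction hβ using AddSubmonoid.closure_induction with
  | mem β hβ =>
    obtain ⟨α, hα, rfl⟩ := hβ
    obtain ⟨k, hk, h⟩ := exists_weightForm_eq_mul_apply_coroot α
    right
    rw [h, sumPosRoots_apply_coroot hα, Complex.re_ofReal_mul, Complex.re_ofNat]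
    positivity
  | zero => simp
  | add x y _ _ hx hy =>
    rcases hx with rfl | hx
    · simpa using hy
    rcases hy with rfl | hy
    · simpa using Or.inr hx
    · right
      rw [map_add, Complex.add_re]; positivity

/-- The element measuring height. It shows that the positive cone is pointed and singles out a
maximal weight when a highest weight vector is sought. -/
theorem exists_apply_eq_one (b : (rootSystem H).Base) :
    ∃ x : H, ∀ α ∈ b.support, (rootSystem H).root α x = 1 := by
  refine ⟨(Module.evalEquiv ℂ H).symm (b.toWeightBasis.constr ℂ fun _ => 1), fun α hα => ?_⟩
  rw [Module.apply_evalEquiv_symm_apply, ← b.toWeightBasis_apply ⟨α, hα⟩, Module.Basis.constr_basis]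

theorem exists_nat_apply_eq {x : H} (hx : ∀ α ∈ b.support, (rootSystem H).root α x = 1)
    {β : Module.Dual ℂ H} (hβ : β ∈ positiveCone b) :
    ∃ n : ℕ, β x = n ∧ (n = 0 → β = 0) := by
  induction hβ using AddSubmonoid.closure_induction with
  | mem β hβ =>
    obtain ⟨α, hα, rfl⟩ := hβ
    exact ⟨1, by simpa using hx α hα, by simp⟩
  | zero => exact ⟨0, by simp⟩
  | add y z _ _ hy hz =>
    obtain ⟨m, hm, hm'⟩ := hy
    obtain ⟨n, hn, hn'⟩ := hz
    refine ⟨m + n, by simp [hm, hn], fun h => ?_⟩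
    rw [hm' (by omega), hn' (by omega), add_zero]

theorem positiveCone_eq_zero_of_add_eq_zero {β γ : Module.Dual ℂ H} (hβ : β ∈ positiveCone b)
    (hγ : γ ∈ positiveCone b) (h : β + γ = 0) : β = 0 := by
  obtain ⟨x, hx⟩ := exists_apply_eq_one b
  obtain ⟨m, hm, hm'⟩ := exists_nat_apply_eq hx hβ
  obtain ⟨n, hn, hn'⟩ := exists_nat_apply_eq hx hγ
  have h1 : (m : ℂ) + n = 0 := by rw [← hm, ← hn, ← LinearMap.add_apply, h]; rfl
  have h2 : m + n = 0 := by exact_mod_cast h1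
  exact hm' (by omega)

/-- The eigenvalue of the Casimir operator on a highest weight vector. -/
noncomputable def casimirEigenvalue (b : (rootSystem H).Base) (μ : Module.Dual ℂ H) : ℂ :=
  weightForm H μ μ + weightForm H μ (sumPosRoots b)

theorem eq_zero_of_casimirEigenvalue_add_eq {μ β : Module.Dual ℂ H}
    (hμ : ∀ α : H.root, b.IsPos α → ∃ n : ℕ, μ (coroot α.1) = n)
    (hμβ : ∀ α : H.root, b.IsPos α → ∃ n : ℕ, (μ + β) (coroot α.1) = n)
    (hβ : β ∈ positiveCone b) (h : casimirEigenvalue b (μ + β) = casimirEigenvalue b μ) :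
    β = 0 := by
  refine (eq_zero_or_weightForm_sumPosRoots_re_pos hβ).resolve_right fun hpos => ?_
  have h1 := weightForm_re_nonneg hμ hβ
  have h2 := weightForm_re_nonneg hμβ hβ
  -- This is the difference of the two eigenvalues. The first two terms have nonnegative real part
  -- by dominance, the third a positive one.
  have h3 : weightForm H (μ + β) β + weightForm H μ β + weightForm H (sumPosRoots b) β = 0 := by
    rw [casimirEigenvalue, casimirEigenvalue] at h
    rw [weightForm_comm (sumPosRoots b) β]
    simp only [map_add, LinearMap.add_apply] at h ⊢
    rw [weightForm_comm β μ] at *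
    linear_combination h
  have h4 := congrArg Complex.re h3
  simp only [Complex.add_re, Complex.zero_re] at h4
  linarith

end WeightForm

/-! ### Weight vectors and highest weight vectors. -/

section HighestWeight

variable {L : Type*} [LieRing L] [LieAlgebra ℂ L] [FiniteDimensional ℂ L] [IsKilling ℂ L]
  {H : LieSubalgebra ℂ L} [H.IsCartanSubalgebra] {b : (rootSystem H).Base}

theorem neg_root_coe (α : H.root) :
    letI := (rootSystem H).indexNeg
    (((-α : H.root) : LieModule.Weight ℂ H L) : H → ℂ) = -((α : LieModule.Weight ℂ H L) : H → ℂ) := by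
  let := (rootSystem H).indexNeg
  have h : (rootSystem H).root (-α) = -(rootSystem H).root α := by
    rw [RootPairing.indexNeg_neg, RootPairing.root_reflectionPerm, RootPairing.reflection_apply_self]
  ext x
  exact LinearMap.congr_fun h x

theorem triangular_induction (b : (rootSystem H).Base) {p : L → Prop} (x : L)
    (cartan : ∀ h : H, p h)
    (pos : ∀ α : H.root, b.IsPos α → ∀ y ∈ rootSpace H (α : LieModule.Weight ℂ H L), p y)
    (neg : ∀ α : H.root, b.IsPos α → ∀ y ∈ rootSpace H (-(α : LieModule.Weight ℂ H L)), p y)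
    (add : ∀ y z, p y → p z → p (y + z)) : p x := by
  have hz : x ∈ ⨆ β, rootSpace H β := by simp [LieModule.iSup_genWeightSpace_eq_top ℂ H L]
  have h0 : p 0 := cartan 0
  induction hz using LieSubmodule.iSup_induction' with
  | mem β y hy =>
    by_cases hβ : β = 0
    · subst hβ
      exact cartan ⟨y, by simpa using hy⟩
    by_cases hy0 : y = 0
    · rwa [hy0]
    let βw : LieModule.Weight ℂ H L := ⟨β, fun h => hy0 (by simpa [h] using hy)⟩
    have hβw : βw.IsNonZero := hβ
    let α : H.root := ⟨βw, by simpa using hβw⟩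
    let := (rootSystem H).indexNeg
    rcases RootPairing.Base.IsPos.or_neg b α with h | h
    · exact pos α h y hy
    · refine neg (-α) h y ?_
      rw [neg_root_coe, neg_neg]
      exact hy
  | zero => exact h0
  | add y z _ _ hy hz => exact add y z hy hz

variable {M : Type*} [AddCommGroup M] [Module ℂ M] [LieRingModule L M] [LieModule ℂ L M]

variable (M) in
/-- The space of weight vectors of weight `μ`. -/
def weightVectors (μ : Module.Dual ℂ H) : Submodule ℂ M :=
  (LieModule.weightSpace M (μ : H → ℂ)).toSubmodule

omit [FiniteDimensional ℂ L] [IsKilling ℂ L] [H.IsCartanSubalgebra] in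
theorem mem_weightVectors {μ : Module.Dual ℂ H} {m : M} :
    m ∈ weightVectors M μ ↔ ∀ h : H, ⁅(h : L), m⁆ = μ h • m :=
  LieModule.mem_weightSpace (μ : H → ℂ) m

omit [FiniteDimensional ℂ L] [IsKilling ℂ L] [H.IsCartanSubalgebra] in
theorem map_mem_weightVectors {N : Type*} [AddCommGroup N] [Module ℂ N] [LieRingModule L N]
    [LieModule ℂ L N] (f : M →ₗ⁅ℂ,L⁆ N) {μ : Module.Dual ℂ H} {m : M}
    (hm : m ∈ weightVectors M μ) : f m ∈ weightVectors N μ := by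
  rw [mem_weightVectors] at hm ⊢
  intro h
  rw [← LieModuleHom.map_lie, hm, map_smul]

theorem lie_mem_weightVectors {μ α : Module.Dual ℂ H} {x : L} {m : M}
    (hx : x ∈ rootSpace H (α : H → ℂ)) (hm : m ∈ weightVectors M μ) :
    ⁅x, m⁆ ∈ weightVectors M (μ + α) := by
  rw [mem_weightVectors] at hm ⊢
  intro h
  have h1 : ⁅(h : L), x⁆ = α h • x := lie_eq_smul_of_mem_rootSpace hx h
  rw [leibniz_lie, h1, hm, smul_lie, lie_smul, LinearMap.add_apply, add_smul, add_comm]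

omit [FiniteDimensional ℂ L] [IsKilling ℂ L] in
theorem eq_zero_of_mem_span_weightVectors {T : Set (Module.Dual ℂ H)} {μ : Module.Dual ℂ H}
    {m : M} (hμ : μ ∉ T) (hm : m ∈ weightVectors M μ)
    (hT : m ∈ Submodule.span ℂ {u : M | ∃ ν ∈ T, u ∈ weightVectors M ν}) : m = 0 := by
  have h := LieModule.iSupIndep_genWeightSpace ℂ H M (μ : H → ℂ)
  rw [disjoint_iff, ← LieSubmodule.toSubmodule_inj, LieSubmodule.inf_toSubmodule] at h
  have h1 : m ∈ LieModule.genWeightSpace M (μ : H → ℂ) :=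
    LieModule.weightSpace_le_genWeightSpace M _ hm
  have h2 : Submodule.span ℂ {u : M | ∃ ν ∈ T, u ∈ weightVectors M ν} ≤
      (⨆ χ, ⨆ (_ : χ ≠ (μ : H → ℂ)), LieModule.genWeightSpace M χ).toSubmodule := by
    refine Submodule.span_le.2 ?_
    rintro u ⟨ν, hν, hu⟩
    have h3 : LieModule.genWeightSpace M (ν : H → ℂ) ≤
        ⨆ χ, ⨆ (_ : χ ≠ (μ : H → ℂ)), LieModule.genWeightSpace M χ :=
      le_iSup₂_of_le (ν : H → ℂ) (fun h => hμ (DFunLike.coe_injective h ▸ hν)) le_rfl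
    exact h3 (LieModule.weightSpace_le_genWeightSpace M _ hu)
  have h4 := Submodule.mem_inf.2 ⟨h1, h2 hT⟩
  rw [h] at h4
  simpa using h4

variable (b M) in
/-- The span of the weight vectors of weight strictly lower than `μ`. -/
def lowerWeightVectors (μ : Module.Dual ℂ H) : Submodule ℂ M :=
  Submodule.span ℂ {u : M | ∃ ν ∈ {ν | ∃ β ∈ positiveCone b, β ≠ 0 ∧ ν = μ - β},
    u ∈ weightVectors M ν}

theorem mem_lowerWeightVectors_of_mem_weightVectors {μ β : Module.Dual ℂ H} {m : M}
    (hβ : β ∈ positiveCone b) (hβ0 : β ≠ 0) (hm : m ∈ weightVectors M (μ - β)) :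
    m ∈ lowerWeightVectors b M μ :=
  Submodule.subset_span ⟨_, ⟨β, hβ, hβ0, rfl⟩, hm⟩

theorem eq_zero_of_mem_lowerWeightVectors {μ : Module.Dual ℂ H} {m : M}
    (hm : m ∈ weightVectors M μ) (h : m ∈ lowerWeightVectors b M μ) : m = 0 := by
  refine eq_zero_of_mem_span_weightVectors ?_ hm h
  rintro ⟨β, -, hβ0, h⟩
  exact hβ0 (by simpa using h.symm)

theorem lie_mem_lowerWeightVectors {μ : Module.Dual ℂ H} {v : M} (hv : v ∈ weightVectors M μ)
    {α : H.root} (hα : b.IsPos α) {x : L} (hx : x ∈ rootSpace H (-(α : LieModule.Weight ℂ H L)))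
    {m : M} (hm : m ∈ ℂ ∙ v ⊔ lowerWeightVectors b M μ) : ⁅x, m⁆ ∈ lowerWeightVectors b M μ := by
  have hx' : x ∈ rootSpace H ((-(rootSystem H).root α : Module.Dual ℂ H) : H → ℂ) := hx
  have key : ∀ β ∈ positiveCone b, ∀ u ∈ weightVectors M (μ - β),
      ⁅x, u⁆ ∈ lowerWeightVectors b M μ := fun β hβ u hu => by
    refine mem_lowerWeightVectors_of_mem_weightVectors (add_mem hβ (root_mem_positiveCone hα))
      (fun h => (rootSystem H).ne_zero α (positiveCone_eq_zero_of_add_eq_zero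
        (root_mem_positiveCone hα) hβ (by rwa [add_comm]))) ?_
    have := lie_mem_weightVectors hx' hu
    rwa [← sub_eq_add_neg, sub_sub] at this
  obtain ⟨y, hy, z, hz, rfl⟩ := Submodule.mem_sup.1 hm
  obtain ⟨c, rfl⟩ := Submodule.mem_span_singleton.1 hy
  rw [lie_add, lie_smul]
  refine add_mem (Submodule.smul_mem _ _ (key 0 (zero_mem _) v (by simpa using hv))) ?_
  suffices lowerWeightVectors b M μ ≤
      (lowerWeightVectors b M μ).comap (LieModule.toEnd ℂ L M x) from this hz
  refine Submodule.span_le.2 ?_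
  rintro u ⟨_, ⟨β, hβ, -, rfl⟩, hu⟩
  exact key β hβ u hu

/-- A submodule generated by a highest weight vector `v` of weight `μ` is spanned by `v` and by
vectors of lower weight. -/
theorem lieSpan_le_of_isHighestWeightVector {μ : Module.Dual ℂ H} {v : M}
    (hv : IsHighestWeightVector b v) (hμ : v ∈ weightVectors M μ) :
    (LieSubmodule.lieSpan ℂ L {v}).toSubmodule ≤ ℂ ∙ v ⊔ lowerWeightVectors b M μ := by
  -- In place of the Poincaré-Birkhoff-Witt theorem: `W` is the least subspace containing v and
  -- closed under negative root vectors, and `W'` is the part of `W` that all of L maps into `W`. As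
  -- `W'` is again stable, minimality gives `W ≤ W'`, so `W` is a subrepresentation.
  let stable : Set (Submodule ℂ M) := {p | v ∈ p ∧ ∀ α : H.root, b.IsPos α →
    ∀ x ∈ rootSpace H (-(α : LieModule.Weight ℂ H L)), ∀ m ∈ p, ⁅x, m⁆ ∈ p}
  let W : Submodule ℂ M := sInf stable
  have hvW : v ∈ W := Submodule.mem_sInf.2 fun p hp => hp.1
  have hW : ∀ α : H.root, b.IsPos α →
      ∀ x ∈ rootSpace H (-(α : LieModule.Weight ℂ H L)), ∀ m ∈ W, ⁅x, m⁆ ∈ W :=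
    fun α hα x hx m hm => Submodule.mem_sInf.2 fun p hp =>
      hp.2 α hα x hx m (Submodule.mem_sInf.1 hm p hp)
  let W' : Submodule ℂ M :=
    { carrier := {m | m ∈ W ∧ ∀ x : L, ⁅x, m⁆ ∈ W}
      add_mem' := fun h1 h2 => ⟨add_mem h1.1 h2.1, fun x => by
        rw [lie_add]; exact add_mem (h1.2 x) (h2.2 x)⟩
      zero_mem' := ⟨zero_mem _, fun x => by rw [lie_zero]; exact zero_mem _⟩
      smul_mem' := fun c m h => ⟨W.smul_mem c h.1, fun x => by
        rw [lie_smul]; exact W.smul_mem c (h.2 x)⟩ }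
  have hW' : W' ∈ stable := by
    refine ⟨⟨hvW, fun x => ?_⟩, fun α hα x hx m hm => ⟨hW α hα x hx m hm.1, fun y => ?_⟩⟩
    · induction x using triangular_induction b with
      | cartan h => rw [mem_weightVectors.1 hμ]; exact W.smul_mem _ hvW
      | pos α hα y hy => rw [hv.lie_eq_zero α hα y hy]; exact zero_mem _
      | neg α hα y hy => exact hW α hα y hy v hvW
      | add y z hy hz => rw [add_lie]; exact add_mem hy hz
    · rw [leibniz_lie]
      exact add_mem (hm.2 _) (hW α hα x hx _ (hm.2 y))
  have hle : W ≤ W' := sInf_le hW'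
  let W'' : LieSubmodule ℂ L M := { W with lie_mem := fun {x m} hm => (hle hm).2 x }
  have h1 : LieSubmodule.lieSpan ℂ L {v} ≤ W'' :=
    LieSubmodule.lieSpan_le.2 (Set.singleton_subset_iff.2 hvW)
  have h2 : W ≤ ℂ ∙ v ⊔ lowerWeightVectors b M μ :=
    sInf_le ⟨Submodule.mem_sup_left (Submodule.mem_span_singleton_self v),
      fun α hα x hx m hm => Submodule.mem_sup_right (lie_mem_lowerWeightVectors hμ hα hx hm)⟩
  exact le_trans (fun m hm => h1 hm) h2

/-- The Cartan part contributes (μ,μ). For positive α one rewrites ef = fe + [e,f], where e kills v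
and [e,f] acts by (μ,α). For negative α the right factor is already a positive root vector and kills
v. -/
theorem casimir_apply_of_isHighestWeightVector {μ : Module.Dual ℂ H} {v : M}
    (hv : IsHighestWeightVector b v) (hμ : v ∈ weightVectors M μ) :
    casimir H M v = casimirEigenvalue b μ • v := by
  classical
  rw [mem_weightVectors] at hμ
  rw [casimir_apply, Fintype.sum_sum_type, casimirEigenvalue, add_smul]
  congr 1
  · have h1 : ∀ i, LieModule.traceForm ℂ H L (cartanDualBasis H i) ((cartanEquivDual H).symm μ) =
        μ (cartanDualBasis H i) := fun i => by
      rw [LieModule.traceForm_comm]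
      exact LinearMap.congr_fun ((cartanEquivDual H).apply_symm_apply μ) _
    have h2 := congrArg μ (sum_traceForm_cartanDualBasis_smul H ((cartanEquivDual H).symm μ))
    rw [weightForm_apply, ← h2, map_sum, Finset.sum_smul]
    refine Finset.sum_congr rfl fun i _ => ?_
    rw [killingLeft, killingRight, Sum.elim_inl, Sum.elim_inl, hμ, lie_smul, hμ, smul_smul, h1,
      map_smul, smul_eq_mul]
  · rw [sumPosRoots, map_sum, Finset.sum_smul, Finset.sum_filter]
    refine Finset.sum_congr rfl fun α _ => ?_
    rw [killingLeft, killingRight, Sum.elim_inr, Sum.elim_inr]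
    have he := rootPair_fst_mem H α.1
    have hf := rootPair_snd_mem H α.1
    rw [LieModule.Weight.coe_neg] at hf
    split_ifs with hα
    · rw [leibniz_lie, hv.lie_eq_zero α hα _ he, lie_zero, add_zero,
        lie_eq_killingForm_smul_of_mem_rootSpace_of_mem_rootSpace_neg he hf, killingForm_rootPair,
        one_smul, hμ]
      rfl
    · let := (rootSystem H).indexNeg
      have hα' := (RootPairing.Base.IsPos.neg_iff_not b α).2 hα
      rw [hv.lie_eq_zero (-α) hα' _ (by rw [neg_root_coe]; exact hf), lie_zero]

variable [FiniteDimensional ℂ M]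

/-- For the sl₂-triple of α, v is a primitive vector in a finite-dimensional module. -/
theorem exists_nat_apply_coroot_eq {μ : Module.Dual ℂ H} {v : M}
    (hv : IsHighestWeightVector b v) (hμ : v ∈ weightVectors M μ) (α : H.root) (hα : b.IsPos α) :
    ∃ n : ℕ, μ (coroot α.1) = n := by
  obtain ⟨h, e, f, ht, he, hf⟩ := exists_isSl2Triple_of_weight_isNonZero (H.isNonZero_coe_root α)
  have hh := ht.h_eq_coroot (H.isNonZero_coe_root α) he hf
  have P : ht.HasPrimitiveVectorWith v (μ (coroot α.1)) :=
    ⟨hv.ne_zero, by rw [hh]; exact mem_weightVectors.1 hμ _, hv.lie_eq_zero α hα e he⟩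
  exact P.exists_nat

theorem exists_isHighestWeightVector (b : (rootSystem H).Base) [Nontrivial M] :
    ∃ v : M, IsHighestWeightVector b v := by
  let T : Set (Module.Dual ℂ H) := {μ | weightVectors M μ ≠ ⊥}
  have hfin : T.Finite := by
    refine Set.Finite.of_finite_image (f := fun μ : Module.Dual ℂ H => (μ : H → ℂ)) ?_
      DFunLike.coe_injective.injOn
    refine (LieModule.finite_genWeightSpace_ne_bot ℂ H M).subset ?_
    rintro _ ⟨μ, hμ, rfl⟩ h
    refine hμ ?_
    rw [eq_bot_iff]
    intro m hm
    have h1 : m ∈ LieModule.genWeightSpace M (μ : H → ℂ) :=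
      LieModule.weightSpace_le_genWeightSpace M _ hm
    rw [h] at h1
    simpa using h1
  have hne : T.Nonempty := by
    obtain ⟨χ, hχ⟩ := LieModule.exists_nontrivial_weightSpace_of_isSolvable ℂ H M
    refine ⟨χ, fun h => ?_⟩
    obtain ⟨⟨m, hm⟩, hm0⟩ := exists_ne (0 : LieModule.weightSpace M χ)
    have h1 : m ∈ weightVectors M χ := hm
    rw [h] at h1
    exact hm0 (by simpa using h1)
  obtain ⟨x, hx⟩ := exists_apply_eq_one b
  -- A positive root vector raises the height by a positive integer, so it must kill a weight vector
  -- of maximal height. Weights may take complex values on `x`, hence the real part.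
  obtain ⟨μ, hμ, hmax⟩ := Set.exists_max_image T (fun μ => (μ x).re) hfin hne
  obtain ⟨v, hv, hv0⟩ := Submodule.exists_mem_ne_zero_of_ne_bot hμ
  refine ⟨v, hv0, ⟨μ, mem_weightVectors.1 hv⟩, fun α hα y hy => ?_⟩
  by_contra h0
  have hy' : y ∈ rootSpace H (((rootSystem H).root α : Module.Dual ℂ H) : H → ℂ) := hy
  have h1 := lie_mem_weightVectors hy' hv
  have h2 : μ + (rootSystem H).root α ∈ T := fun h => h0 (by rw [h] at h1; simpa using h1)
  have h3 := hmax _ h2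
  obtain ⟨n, hn, hn'⟩ := exists_nat_apply_eq hx (root_mem_positiveCone hα)
  rw [LinearMap.add_apply, hn, Complex.add_re, Complex.natCast_re] at h3
  have h4 : (n : ℝ) = 0 := le_antisymm (by linarith) (Nat.cast_nonneg n)
  exact (rootSystem H).ne_zero α (hn' (by exact_mod_cast h4))

end HighestWeight

/-! ### Submodules generated by a highest weight vector, and their complements. -/

section HighestWeightSubmodule

variable {L : Type*} [LieRing L] [LieAlgebra ℂ L] [FiniteDimensional ℂ L] [IsKilling ℂ L]
  {H : LieSubalgebra ℂ L} [H.IsCartanSubalgebra] {b : (rootSystem H).Base}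
  {M : Type*} [AddCommGroup M] [Module ℂ M] [LieRingModule L M] [LieModule ℂ L M]

theorem IsHighestWeightVector.exists_mem_weightVectors {v : M} (hv : IsHighestWeightVector b v) :
    ∃ μ : Module.Dual ℂ H, v ∈ weightVectors M μ :=
  hv.exists_weight.imp fun _ h => mem_weightVectors.2 h

omit [LieModule ℂ L M] in
theorem IsHighestWeightVector.map {N : Type*} [AddCommGroup N] [Module ℂ N] [LieRingModule L N]
    [LieModule ℂ L N] {v : M} (hv : IsHighestWeightVector b v) (f : M →ₗ⁅ℂ,L⁆ N)
    (hf : Function.Injective f) : IsHighestWeightVector b (f v) where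
  ne_zero h := hv.ne_zero (hf (by rw [h, map_zero]))
  exists_weight := hv.exists_weight.imp fun μ hμ h => by
    rw [← LieModuleHom.map_lie, hμ, map_smul]
  lie_eq_zero α hα x hx := by rw [← LieModuleHom.map_lie, hv.lie_eq_zero α hα x hx, map_zero]

omit [LieModule ℂ L M] in
theorem IsHighestWeightVector.of_map {N : Type*} [AddCommGroup N] [Module ℂ N] [LieRingModule L N]
    [LieModule ℂ L N] {v : M} (f : M →ₗ⁅ℂ,L⁆ N) (hf : Function.Injective f)
    (hv : IsHighestWeightVector b (f v)) : IsHighestWeightVector b v where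
  ne_zero h := hv.ne_zero (by rw [h, map_zero])
  exists_weight := hv.exists_weight.imp fun μ hμ h => hf (by
    rw [LieModuleHom.map_lie, hμ, map_smul])
  lie_eq_zero α hα x hx := hf (by
    rw [LieModuleHom.map_lie, hv.lie_eq_zero α hα x hx, map_zero])

theorem IsHighestWeightVector.smul {v : M} (hv : IsHighestWeightVector b v) {c : ℂ} (hc : c ≠ 0) :
    IsHighestWeightVector b (c • v) where
  ne_zero := smul_ne_zero hc hv.ne_zero
  exists_weight := hv.exists_weight.imp fun μ hμ h => by rw [lie_smul, hμ, smul_comm]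
  lie_eq_zero α hα x hx := by rw [lie_smul, hv.lie_eq_zero α hα x hx, smul_zero]

/-- The highest weight vector of an irreducible representation is unique up to scalars. -/
theorem exists_smul_eq_of_isHighestWeightVector [LieModule.IsIrreducible ℂ L M] {v w : M}
    (hv : IsHighestWeightVector b v) (hw : IsHighestWeightVector b w) :
    ∃ c : ℂ, c ≠ 0 ∧ w = c • v := by
  have htop : ∀ {u : M}, IsHighestWeightVector b u → LieSubmodule.lieSpan ℂ L {u} = ⊤ := fun {u} hu =>
    (IsSimpleOrder.eq_bot_or_eq_top _).resolve_left fun h => hu.ne_zero (by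
      have h1 : u ∈ LieSubmodule.lieSpan ℂ L {u} := LieSubmodule.subset_lieSpan rfl
      rw [h] at h1
      simpa using h1)
  obtain ⟨μ, hμ⟩ := hv.exists_mem_weightVectors
  obtain ⟨ν, hν⟩ := hw.exists_mem_weightVectors
  -- Either vector generates the module, so each weight lies below the other and the two coincide
  -- because the cone is pointed.
  have key : ∀ {u u' : M} {μ ν : Module.Dual ℂ H}, IsHighestWeightVector b u →
      u ∈ weightVectors M μ → u' ≠ 0 → u' ∈ weightVectors M ν →
      ∃ β ∈ positiveCone b, ν = μ - β := fun {u u' μ ν} hu hμ hu' hν => by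
    have h1 := lieSpan_le_of_isHighestWeightVector hu hμ
    rw [htop hu] at h1
    have h2 : u' ∈ ℂ ∙ u ⊔ lowerWeightVectors b M μ := h1 (LieSubmodule.mem_top u')
    by_contra hcon
    refine hu' (eq_zero_of_mem_span_weightVectors
      (T := {ν | ∃ β ∈ positiveCone b, ν = μ - β}) hcon hν ?_)
    suffices h3 : ℂ ∙ u ⊔ lowerWeightVectors b M μ ≤ Submodule.span ℂ {y : M |
        ∃ ν ∈ {ν | ∃ β ∈ positiveCone b, ν = μ - β}, y ∈ weightVectors M ν} from h3 h2
    refine sup_le ?_ ?_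
    · rw [Submodule.span_singleton_le_iff_mem]
      exact Submodule.subset_span ⟨μ, ⟨0, zero_mem _, by simp⟩, hμ⟩
    · refine Submodule.span_mono ?_
      rintro y ⟨_, ⟨β, hβ, -, rfl⟩, hy⟩
      exact ⟨_, ⟨β, hβ, rfl⟩, hy⟩
  obtain ⟨β, hβ, rfl⟩ := key hv hμ hw.ne_zero hν
  obtain ⟨γ, hγ, h⟩ := key hw hν hv.ne_zero hμ
  have hβ0 : β = 0 := positiveCone_eq_zero_of_add_eq_zero hβ hγ (by
    rw [sub_sub, eq_comm, sub_eq_self] at h; exact h)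
  subst hβ0
  rw [sub_zero] at hν
  have h1 := lieSpan_le_of_isHighestWeightVector hv hμ
  rw [htop hv] at h1
  obtain ⟨y, hy, z, hz, hyz⟩ := Submodule.mem_sup.1 (h1 (LieSubmodule.mem_top w))
  obtain ⟨c, rfl⟩ := Submodule.mem_span_singleton.1 hy
  have hz' : z ∈ weightVectors M μ := by
    rw [← eq_sub_iff_add_eq'] at hyz
    rw [hyz]
    exact sub_mem hν (Submodule.smul_mem _ _ hμ)
  rw [eq_zero_of_mem_lowerWeightVectors hz' hz, add_zero] at hyz
  refine ⟨c, ?_, hyz.symm⟩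
  rintro rfl
  exact hw.ne_zero (by rw [← hyz, zero_smul])

variable (M) in
/-- The powers of the Casimir operator minus a scalar, as homomorphisms of representations. -/
noncomputable def casimirSubPow (H : LieSubalgebra ℂ L) [H.IsCartanSubalgebra] (c : ℂ) (n : ℕ) :
    M →ₗ⁅ℂ,L⁆ M :=
  { (casimir H M - c • 1) ^ n with
    map_lie' := by
      intro x m
      change ((casimir H M - c • 1) ^ n) ⁅x, m⁆ = ⁅x, ((casimir H M - c • 1) ^ n) m⁆
      induction n generalizing m with
      | zero => simp
      | succ n ih =>
        rw [pow_succ, Module.End.mul_apply, Module.End.mul_apply, ← ih]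
        congr 1
        simp [casimir_lie] }

theorem casimirSubPow_apply (c : ℂ) (n : ℕ) (m : M) :
    casimirSubPow M H c n m = ((casimir H M - c • 1) ^ n) m := rfl

theorem map_casimirSubPow {N : Type*} [AddCommGroup N] [Module ℂ N] [LieRingModule L N]
    [LieModule ℂ L N] (f : M →ₗ⁅ℂ,L⁆ N) (c : ℂ) (n : ℕ) (m : M) :
    f (casimirSubPow M H c n m) = casimirSubPow N H c n (f m) := by
  simp only [casimirSubPow_apply]
  induction n generalizing m with
  | zero => simp
  | succ n ih =>
    rw [pow_succ, pow_succ, Module.End.mul_apply, Module.End.mul_apply, ih]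
    simp [map_casimir]

theorem casimirSubPow_apply_of_casimir_apply {a : ℂ} {m : M} (hm : casimir H M m = a • m)
    (c : ℂ) (n : ℕ) : casimirSubPow M H c n m = (a - c) ^ n • m := by
  simp only [casimirSubPow_apply]
  induction n with
  | zero => simp
  | succ n ih =>
    rw [pow_succ', Module.End.mul_apply, ih, map_smul]
    simp only [LinearMap.sub_apply, LinearMap.smul_apply, Module.End.one_apply, hm]
    rw [← sub_smul, smul_smul, pow_succ]

variable [FiniteDimensional ℂ M]

/-- If all weights of `M` are at most `μ` and the Casimir operator acts on the subrepresentation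
`N ≠ 0` with the generalized eigenvalue belonging to `μ`, then `N` has a vector of weight `μ`. -/
theorem exists_isHighestWeightVector_mem {μ : Module.Dual ℂ H}
    (hμ : ∀ α : H.root, b.IsPos α → ∃ n : ℕ, μ (coroot α.1) = n)
    (hM : Submodule.span ℂ {u : M | ∃ ν ∈ {ν | ∃ β ∈ positiveCone b, ν = μ - β},
      u ∈ weightVectors M ν} = ⊤)
    {N : LieSubmodule ℂ L M} (hN : N ≠ ⊥) {n : ℕ}
    (hc : ∀ u ∈ N, casimirSubPow M H (casimirEigenvalue b μ) n u = 0) :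
    ∃ u ∈ N, IsHighestWeightVector b u ∧ u ∈ weightVectors M μ := by
  have : Nontrivial N := (LieSubmodule.nontrivial_iff_ne_bot ℂ L M).2 hN
  obtain ⟨u', hu'⟩ := exists_isHighestWeightVector (M := N) b
  have hu := hu'.map N.incl N.injective_incl
  set u : M := N.incl u' with hudef
  have huN : u ∈ N := u'.2
  obtain ⟨ν, hν⟩ := hu.exists_mem_weightVectors
  refine ⟨u, huN, hu, ?_⟩
  -- On `u` the power acts by (c_ν - c_μ)^n. Its vanishing forces equal Casimir eigenvalues, and
  -- hence ν = μ.
  have h1 := casimirSubPow_apply_of_casimir_apply (casimir_apply_of_isHighestWeightVector hu hν)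
    (casimirEigenvalue b μ) n
  rw [hc u huN] at h1
  have h3 := (smul_eq_zero.1 h1.symm).resolve_right hu.ne_zero
  have h4 : casimirEigenvalue b ν - casimirEigenvalue b μ = 0 := eq_zero_of_pow_eq_zero h3
  obtain ⟨β, hβ, rfl⟩ : ν ∈ {ν | ∃ β ∈ positiveCone b, ν = μ - β} := by
    by_contra hcon
    exact hu.ne_zero (eq_zero_of_mem_span_weightVectors hcon hν (by rw [hM]; trivial))
  have h5 : β = 0 := eq_zero_of_casimirEigenvalue_add_eq (b := b) (μ := μ - β)
    (exists_nat_apply_coroot_eq hu hν) (by simpa using hμ) hβ (by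
      rw [sub_add_cancel]; exact (sub_eq_zero.1 h4).symm)
  rwa [h5, sub_zero] at hν

-- The Casimir operator commutes with L, so its eigenspaces are subrepresentations.
omit [FiniteDimensional ℂ M] in
theorem casimir_apply_of_mem_lieSpan {a : ℂ} {v m : M} (hv : casimir H M v = a • v)
    (hm : m ∈ LieSubmodule.lieSpan ℂ L {v}) : casimir H M m = a • m := by
  have h : LieSubmodule.lieSpan ℂ L {v} ≤ (casimirSubPow M H a 1).ker :=
    LieSubmodule.lieSpan_le.2 (Set.singleton_subset_iff.2 (by
      simp [casimirSubPow_apply, hv]))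
  have h1 := h hm
  rw [LieModuleHom.mem_ker, casimirSubPow_apply] at h1
  simpa [sub_eq_zero] using h1

/-- If `M` is spanned by a highest weight vector `v` and vectors of lower weight, then `v` generates
an irreducible direct summand, and this summand is an eigenspace of the Casimir operator. -/
theorem isIrreducibleSummand_lieSpan {μ : Module.Dual ℂ H} {v : M}
    (hv : IsHighestWeightVector b v) (hμ : v ∈ weightVectors M μ)
    (hM : ℂ ∙ v ⊔ lowerWeightVectors b M μ = ⊤) :
    IsIrreducibleSummand (LieSubmodule.lieSpan ℂ L {v}) ∧
      ∀ m : M, casimir H M m = casimirEigenvalue b μ • m → m ∈ LieSubmodule.lieSpan ℂ L {v} := by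
  set c := casimirEigenvalue b μ with hc
  set S := LieSubmodule.lieSpan ℂ L {v} with hS
  have hvS : v ∈ S := LieSubmodule.subset_lieSpan rfl
  have hdom := exists_nat_apply_coroot_eq hv hμ
  have hcas := casimir_apply_of_isHighestWeightVector hv hμ
  -- Fitting decomposition of the Casimir operator minus c: for large n, kernel and range of the
  -- n-th power are complementary. The condition n ≥ 1 puts genuine eigenvectors into the kernel
  -- `G`.
  obtain ⟨n, hn1, hn⟩ := ((Filter.eventually_ge_atTop 1).and
    (LinearMap.eventually_isCompl_ker_pow_range_pow (casimir H M - c • 1))).exists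
  let G : LieSubmodule ℂ L M := (casimirSubPow M H c n).ker
  let R : LieSubmodule ℂ L M := (casimirSubPow M H c n).range
  have hGR : IsCompl G R := by
    rw [← LieSubmodule.isCompl_toSubmodule]
    convert hn
    · exact LieModuleHom.ker_toSubmodule _
    · exact LieModuleHom.toSubmodule_range _
  have heig : ∀ m : M, casimir H M m = c • m → m ∈ G := fun m hm => by
    rw [LieModuleHom.mem_ker, casimirSubPow_apply_of_casimir_apply hm, sub_self,
      zero_pow (by omega), zero_smul]
  have hSG : S ≤ G := fun m hm => heig m (casimir_apply_of_mem_lieSpan hcas hm)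
  have hspan : Submodule.span ℂ {u : M | ∃ ν ∈ {ν | ∃ β ∈ positiveCone b, ν = μ - β},
      u ∈ weightVectors M ν} = ⊤ := by
    rw [eq_top_iff, ← hM]
    refine sup_le ?_ (Submodule.span_mono ?_)
    · rw [Submodule.span_singleton_le_iff_mem]
      exact Submodule.subset_span ⟨μ, ⟨0, zero_mem _, by simp⟩, hμ⟩
    · rintro y ⟨_, ⟨β, hβ, -, rfl⟩, hy⟩
      exact ⟨_, ⟨β, hβ, rfl⟩, hy⟩
  have hmin : ∀ N : LieSubmodule ℂ L M, N ≤ G → N ≠ ⊥ → v ∈ N := fun N hNG hN => by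
    obtain ⟨u, huN, hu, huμ⟩ := exists_isHighestWeightVector_mem hdom hspan hN (n := n)
      (fun u hu => LieModuleHom.mem_ker.1 (hNG hu))
    have h1 : u ∈ ℂ ∙ v ⊔ lowerWeightVectors b M μ := hM ▸ Submodule.mem_top
    obtain ⟨y, hy, z, hz, hyz⟩ := Submodule.mem_sup.1 h1
    obtain ⟨a, rfl⟩ := Submodule.mem_span_singleton.1 hy
    have hz' : z ∈ weightVectors M μ := by
      rw [← eq_sub_iff_add_eq'] at hyz
      rw [hyz]
      exact sub_mem huμ (Submodule.smul_mem _ _ hμ)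
    rw [eq_zero_of_mem_lowerWeightVectors hz' hz, add_zero] at hyz
    have ha : a ≠ 0 := by
      rintro rfl
      exact hu.ne_zero (by rw [← hyz, zero_smul])
    have := N.smul_mem a⁻¹ huN
    rwa [← hyz, smul_smul, inv_mul_cancel₀ ha, one_smul] at this
  -- Otherwise the image of `G` in `M ⧸ S` would contain a highest weight vector of weight μ,
  -- although the quotient is spanned by vectors of strictly lower weight.
  have hGS : G ≤ S := by
    rw [← LieSubmodule.Quotient.map_mk'_eq_bot_le]
    by_contra hne
    have hlow : lowerWeightVectors b (M ⧸ S) μ = ⊤ := by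
      rw [eq_top_iff]
      rintro q -
      obtain ⟨m, rfl⟩ := LieSubmodule.Quotient.surjective_mk' S q
      have h1 : m ∈ ℂ ∙ v ⊔ lowerWeightVectors b M μ := hM ▸ Submodule.mem_top
      suffices ℂ ∙ v ⊔ lowerWeightVectors b M μ ≤
          (lowerWeightVectors b (M ⧸ S) μ).comap (LieSubmodule.Quotient.mk' S : M →ₗ[ℂ] M ⧸ S) from
        this h1
      refine sup_le ?_ (Submodule.span_le.2 ?_)
      · rw [Submodule.span_singleton_le_iff_mem, Submodule.mem_comap]
        have : LieSubmodule.Quotient.mk' S v = 0 := (LieSubmodule.Quotient.mk_eq_zero S).2 hvS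
        change LieSubmodule.Quotient.mk' S v ∈ _
        rw [this]
        exact zero_mem _
      · rintro y ⟨_, ⟨β, hβ, hβ0, rfl⟩, hy⟩
        exact mem_lowerWeightVectors_of_mem_weightVectors hβ hβ0
          (map_mem_weightVectors (LieSubmodule.Quotient.mk' S) hy)
    have : FiniteDimensional ℂ (M ⧸ S) :=
      Module.Finite.of_surjective (LieSubmodule.Quotient.mk' S : M →ₗ[ℂ] M ⧸ S)
        (LieSubmodule.Quotient.surjective_mk' S)
    obtain ⟨u, -, hu, huμ⟩ := exists_isHighestWeightVector_mem (M := M ⧸ S) (b := b) hdom (by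
      rw [eq_top_iff, ← hlow]
      refine Submodule.span_mono ?_
      rintro y ⟨_, ⟨β, hβ, -, rfl⟩, hy⟩
      exact ⟨_, ⟨β, hβ, rfl⟩, hy⟩) hne (n := n) (by
      intro u hu
      obtain ⟨m, hm, rfl⟩ := (LieSubmodule.mem_map _).1 hu
      rw [← map_casimirSubPow (H := H), LieModuleHom.mem_ker.1 hm, map_zero])
    exact hu.ne_zero (eq_zero_of_mem_lowerWeightVectors huμ (hlow ▸ Submodule.mem_top))
  have hSGeq : S = G := le_antisymm hSG hGS
  refine ⟨⟨?_, R, hSGeq ▸ hGR⟩, fun m hm => hGS (heig m hm)⟩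
  have : Nontrivial S := ⟨⟨v, hvS⟩, 0, fun h => hv.ne_zero (congrArg Subtype.val h)⟩
  refine LieModule.IsIrreducible.mk fun N hN => ?_
  have h1 : v ∈ N.map S.incl := by
    refine hmin _ ?_ ?_
    · rintro m hm
      obtain ⟨m', -, rfl⟩ := (LieSubmodule.mem_map _).1 hm
      exact hSG m'.2
    · intro h
      refine hN ((LieSubmodule.eq_bot_iff N).2 fun m hm => ?_)
      have h2 : S.incl m ∈ N.map S.incl := LieSubmodule.mem_map_of_mem hm
      rw [h, LieSubmodule.mem_bot] at h2
      exact Subtype.ext h2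
  have h2 : S ≤ N.map S.incl := LieSubmodule.lieSpan_le.2 (Set.singleton_subset_iff.2 h1)
  rw [eq_top_iff]
  rintro m -
  obtain ⟨m', hm', h⟩ := (LieSubmodule.mem_map _).1 (h2 m.2)
  rwa [← Subtype.ext (a1 := m') (a2 := m) h]

omit [FiniteDimensional ℂ L] [IsKilling ℂ L] [LieModule ℂ L M] [FiniteDimensional ℂ M] in
/-- An irreducible direct summand pulls back along an injective homomorphism. -/
theorem isIrreducibleSummand_of_map {N : Type*} [AddCommGroup N] [Module ℂ N] [LieRingModule L N]
    [LieModule ℂ L N] (f : N →ₗ⁅ℂ,L⁆ M) (hf : Function.Injective f) {S : LieSubmodule ℂ L N}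
    (hS : IsIrreducibleSummand (S.map f)) : IsIrreducibleSummand S := by
  obtain ⟨hirr, W, hW⟩ := hS
  have hbot : ∀ P : LieSubmodule ℂ L N, P.map f = ⊥ → P = ⊥ := fun P hP => by
    refine (LieSubmodule.eq_bot_iff P).2 fun m hm => hf ?_
    have h2 : f m ∈ P.map f := LieSubmodule.mem_map_of_mem hm
    rw [hP, LieSubmodule.mem_bot] at h2
    rw [h2, map_zero]
  refine ⟨?_, W.comap f, ?_, ?_⟩
  · have : Nontrivial S := by
      rw [LieSubmodule.nontrivial_iff_ne_bot]
      rintro rfl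
      rw [LieSubmodule.map_bot] at hirr
      have := LieModule.nontrivial_of_isIrreducible ℂ L (⊥ : LieSubmodule ℂ L M)
      exact (LieSubmodule.nontrivial_iff_ne_bot ℂ L M).1 this rfl
    refine LieModule.IsIrreducible.mk fun P hP => ?_
    have hPS : (P.map S.incl).map f ≤ S.map f := LieSubmodule.map_mono (by
      rintro m hm
      obtain ⟨m', -, rfl⟩ := (LieSubmodule.mem_map _).1 hm
      exact m'.2)
    have h1 : ((P.map S.incl).map f).comap (S.map f).incl = ⊤ := by
      refine (IsSimpleOrder.eq_bot_or_eq_top _).resolve_left fun h => hP ?_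
      have h2 : (P.map S.incl).map f = ⊥ := by
        refine (LieSubmodule.eq_bot_iff _).2 fun m hm => ?_
        have h3 : (⟨m, hPS hm⟩ : S.map f) ∈ ((P.map S.incl).map f).comap (S.map f).incl := hm
        rw [h, LieSubmodule.mem_bot] at h3
        exact congrArg Subtype.val h3
      refine (LieSubmodule.eq_bot_iff _).2 fun m hm => ?_
      have h4 : S.incl m ∈ P.map S.incl := LieSubmodule.mem_map_of_mem hm
      rw [hbot _ h2, LieSubmodule.mem_bot] at h4
      exact Subtype.ext h4
    rw [eq_top_iff]
    rintro m -
    have h5 : f m ∈ S.map f := LieSubmodule.mem_map_of_mem m.2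
    have h6 : (⟨f m, h5⟩ : S.map f) ∈ ((P.map S.incl).map f).comap (S.map f).incl :=
      h1 ▸ LieSubmodule.mem_top _
    obtain ⟨y, hy, hyf⟩ := (LieSubmodule.mem_map _).1 (show f m ∈ (P.map S.incl).map f from h6)
    obtain ⟨m', hm', rfl⟩ := (LieSubmodule.mem_map _).1 hy
    rwa [← Subtype.ext (a1 := m') (a2 := m) (hf hyf)]
  · rw [disjoint_iff, LieSubmodule.eq_bot_iff]
    rintro m ⟨hm1, hm2⟩
    have h1 : f m ∈ S.map f ⊓ W := ⟨LieSubmodule.mem_map_of_mem hm1, hm2⟩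
    rw [disjoint_iff.1 hW.1, LieSubmodule.mem_bot] at h1
    exact hf (by rw [h1, map_zero])
  · rw [codisjoint_iff, eq_top_iff]
    rintro m -
    have h1 : f m ∈ S.map f ⊔ W := codisjoint_iff.1 hW.2 ▸ LieSubmodule.mem_top _
    obtain ⟨y, hy, z, hz, hyz⟩ := (LieSubmodule.mem_sup _ _ _).1 h1
    obtain ⟨s, hs, rfl⟩ := (LieSubmodule.mem_map _).1 hy
    refine (LieSubmodule.mem_sup _ _ _).2 ⟨s, hs, m - s, ?_, by abel⟩
    rw [LieSubmodule.mem_comap, map_sub, ← hyz, add_sub_cancel_left]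
    exact hz

end HighestWeightSubmodule

/-! ### Slotwise action on tensor powers, permutations of slots, and concatenation. -/

section TensorPower

variable {R L V : Type*} [CommRing R] [LieRing L] [LieAlgebra R L]
  [AddCommGroup V] [Module R V] [LieRingModule L V] [LieModule R L V] {n m : ℕ}

theorem linearMap_eq_of_tprod {P : Type*} [AddCommGroup P] [Module R P]
    (f g : ⨂[R]^n V →ₗ[R] P)
    (h : ∀ v, f (PiTensorProduct.tprod R v) = g (PiTensorProduct.tprod R v)) (t : ⨂[R]^n V) :
    f t = g t :=
  LinearMap.congr_fun (PiTensorProduct.ext (MultilinearMap.ext h)) t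

theorem tensorPower_lie_eq_sum (x : L) (t : ⨂[R]^n V) : ⁅x, t⁆ = ∑ i, tensorPowerLieAt x i t := by
  change tensorPowerLie x t = _
  simp [tensorPowerLie]

theorem tensorPowerLieAt_add (x y : L) (i : Fin n) (t : ⨂[R]^n V) :
    tensorPowerLieAt (x + y) i t = tensorPowerLieAt x i t + tensorPowerLieAt y i t :=
  linearMap_eq_of_tprod (tensorPowerLieAt (x + y) i)
    (tensorPowerLieAt x i + tensorPowerLieAt y i) (fun v => by
      simp [tensorPowerLieAt_tprod]) t

theorem tensorPowerLieAt_smul (c : R) (x : L) (i : Fin n) (t : ⨂[R]^n V) :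
    tensorPowerLieAt (c • x) i t = c • tensorPowerLieAt x i t :=
  linearMap_eq_of_tprod (tensorPowerLieAt (c • x) i) (c • tensorPowerLieAt x i) (fun v => by
    simp [tensorPowerLieAt_tprod]) t

theorem tensorPowerLieAt_comm {i j : Fin n} (hij : i ≠ j) (x y : L) (t : ⨂[R]^n V) :
    tensorPowerLieAt x i (tensorPowerLieAt y j t) =
      tensorPowerLieAt y j (tensorPowerLieAt x i t) :=
  linearMap_eq_of_tprod (tensorPowerLieAt x i ∘ₗ tensorPowerLieAt y j)
    (tensorPowerLieAt y j ∘ₗ tensorPowerLieAt x i) (fun v => by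
      simp only [LinearMap.comp_apply, tensorPowerLieAt_tprod]
      rw [Function.update_of_ne hij, Function.update_of_ne hij.symm, Function.update_comm hij]) t

theorem tensorPowerLieAt_lie (x y : L) (i : Fin n) (t : ⨂[R]^n V) :
    tensorPowerLieAt x i (tensorPowerLieAt y i t) =
      tensorPowerLieAt ⁅x, y⁆ i t + tensorPowerLieAt y i (tensorPowerLieAt x i t) :=
  linearMap_eq_of_tprod (tensorPowerLieAt x i ∘ₗ tensorPowerLieAt y i)
    (tensorPowerLieAt ⁅x, y⁆ i + tensorPowerLieAt y i ∘ₗ tensorPowerLieAt x i) (fun v => by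
      simp only [LinearMap.comp_apply, LinearMap.add_apply, tensorPowerLieAt_tprod,
        Function.update_self, Function.update_idem]
      rw [leibniz_lie x y, MultilinearMap.map_update_add]) t

theorem lie_tensorPowerLieAt (z x : L) (i : Fin n) (t : ⨂[R]^n V) :
    ⁅z, tensorPowerLieAt x i t⁆ = tensorPowerLieAt ⁅z, x⁆ i t + tensorPowerLieAt x i ⁅z, t⁆ := by
  rw [tensorPower_lie_eq_sum, tensorPower_lie_eq_sum, map_sum,
    ← Finset.add_sum_erase Finset.univ _ (Finset.mem_univ i),
    ← Finset.add_sum_erase Finset.univ (fun k => tensorPowerLieAt x i (tensorPowerLieAt z k t))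
      (Finset.mem_univ i), tensorPowerLieAt_lie, add_assoc]
  congr 2
  exact Finset.sum_congr rfl fun k hk =>
    tensorPowerLieAt_comm (Finset.ne_of_mem_erase hk) z x t

theorem reindex_tensorPowerLieAt (e : Fin n ≃ Fin m) (x : L) (i : Fin n) (t : ⨂[R]^n V) :
    PiTensorProduct.reindex R (fun _ => V) e (tensorPowerLieAt x i t) =
      tensorPowerLieAt x (e i) (PiTensorProduct.reindex R (fun _ => V) e t) :=
  linearMap_eq_of_tprod ((PiTensorProduct.reindex R (fun _ => V) e).toLinearMap ∘ₗ
      tensorPowerLieAt x i)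
    (tensorPowerLieAt x (e i) ∘ₗ (PiTensorProduct.reindex R (fun _ => V) e).toLinearMap)
    (fun v => by
      simp only [LinearMap.comp_apply, LinearEquiv.coe_coe, tensorPowerLieAt_tprod]
      rw [PiTensorProduct.reindex_tprod, PiTensorProduct.reindex_tprod, tensorPowerLieAt_tprod,
        Equiv.symm_apply_apply]
      congr 1
      ext k
      simp only [Function.update_apply, Equiv.symm_apply_eq]) t

theorem mulEquiv_tprod_tmul_tprod (a : Fin n → V) (c : Fin m → V) :
    TensorPower.mulEquiv (PiTensorProduct.tprod R a ⊗ₜ[R] PiTensorProduct.tprod R c) =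
      PiTensorProduct.tprod R (Fin.append a c) :=
  TensorPower.tprod_mul_tprod R a c

theorem bilinear_eq_of_tprod {P : Type*} [AddCommGroup P] [Module R P]
    (f g : ⨂[R]^n V →ₗ[R] ⨂[R]^m V →ₗ[R] P)
    (h : ∀ v w, f (PiTensorProduct.tprod R v) (PiTensorProduct.tprod R w) =
      g (PiTensorProduct.tprod R v) (PiTensorProduct.tprod R w)) (s : ⨂[R]^n V) (t : ⨂[R]^m V) :
    f s t = g s t :=
  linearMap_eq_of_tprod (f s) (g s) (fun w =>
    linearMap_eq_of_tprod (f.flip (PiTensorProduct.tprod R w)) (g.flip (PiTensorProduct.tprod R w))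
      (fun v => h v w) s) t

variable (R V n m) in
/-- Concatenation of tensors as a bilinear map. -/
noncomputable def concatBilin : ⨂[R]^n V →ₗ[R] ⨂[R]^m V →ₗ[R] ⨂[R]^(n + m) V :=
  (TensorProduct.mk R _ _).compr₂ TensorPower.mulEquiv.toLinearMap

theorem concatBilin_tprod (a : Fin n → V) (c : Fin m → V) :
    concatBilin R V n m (PiTensorProduct.tprod R a) (PiTensorProduct.tprod R c) =
      PiTensorProduct.tprod R (Fin.append a c) :=
  mulEquiv_tprod_tmul_tprod a c

theorem concatBilin_tensorPowerLieAt_left (x : L) (i : Fin n) (s : ⨂[R]^n V) (t : ⨂[R]^m V) :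
    concatBilin R V n m (tensorPowerLieAt x i s) t =
      tensorPowerLieAt x (Fin.castAdd m i) (concatBilin R V n m s t) :=
  bilinear_eq_of_tprod (concatBilin R V n m ∘ₗ tensorPowerLieAt x i)
    ((concatBilin R V n m).compr₂ (tensorPowerLieAt x (Fin.castAdd m i))) (fun v w => by
      simp only [LinearMap.comp_apply, LinearMap.compr₂_apply, tensorPowerLieAt_tprod,
        concatBilin_tprod]
      congr 1
      ext k
      refine Fin.addCases (fun k => ?_) (fun k => ?_) k
      · simp [Function.update_apply]
      · rw [Function.update_of_ne (by simp [Fin.ext_iff]; omega), Fin.append_right,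
          Fin.append_right]) s t

theorem concatBilin_tensorPowerLieAt_right (x : L) (i : Fin m) (s : ⨂[R]^n V) (t : ⨂[R]^m V) :
    concatBilin R V n m s (tensorPowerLieAt x i t) =
      tensorPowerLieAt x (Fin.natAdd n i) (concatBilin R V n m s t) :=
  bilinear_eq_of_tprod ((concatBilin R V n m).compl₂ (tensorPowerLieAt x i))
    ((concatBilin R V n m).compr₂ (tensorPowerLieAt x (Fin.natAdd n i))) (fun v w => by
      simp only [LinearMap.compl₂_apply, LinearMap.compr₂_apply, tensorPowerLieAt_tprod,
        concatBilin_tprod]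
      congr 1
      ext k
      refine Fin.addCases (fun k => ?_) (fun k => ?_) k
      · rw [Function.update_of_ne (by simp [Fin.ext_iff]; omega), Fin.append_left,
          Fin.append_left]
      · simp [Function.update_apply]) s t

theorem lie_concatBilin (x : L) (s : ⨂[R]^n V) (t : ⨂[R]^m V) :
    ⁅x, concatBilin R V n m s t⁆ = concatBilin R V n m ⁅x, s⁆ t + concatBilin R V n m s ⁅x, t⁆ := by
  simp only [tensorPower_lie_eq_sum, Fin.sum_univ_add, map_sum, LinearMap.sum_apply,
    concatBilin_tensorPowerLieAt_left, concatBilin_tensorPowerLieAt_right]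

theorem reindex_swap_concatBilin (i j : Fin n) (s : ⨂[R]^n V) (t : ⨂[R]^m V) :
    PiTensorProduct.reindex R (fun _ => V) (Equiv.swap (Fin.castAdd m i) (Fin.castAdd m j))
        (concatBilin R V n m s t) =
      concatBilin R V n m (PiTensorProduct.reindex R (fun _ => V) (Equiv.swap i j) s) t :=
  bilinear_eq_of_tprod
    ((concatBilin R V n m).compr₂ (PiTensorProduct.reindex R (fun _ => V)
      (Equiv.swap (Fin.castAdd m i) (Fin.castAdd m j))).toLinearMap)
    (concatBilin R V n m ∘ₗ (PiTensorProduct.reindex R (fun _ => V) (Equiv.swap i j)).toLinearMap)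
    (fun v w => by
      simp only [LinearMap.comp_apply, LinearMap.compr₂_apply, LinearEquiv.coe_coe,
        concatBilin_tprod]
      rw [PiTensorProduct.reindex_tprod, PiTensorProduct.reindex_tprod, concatBilin_tprod]
      congr 1
      ext k
      refine Fin.addCases (fun k => ?_) (fun k => ?_) k
      · simp only [Equiv.symm_swap, Equiv.swap_apply_def, Fin.append_left]
        simp only [Fin.ext_iff, Fin.val_castAdd]
        split_ifs <;> simp
      · rw [Equiv.symm_swap, Equiv.swap_apply_of_ne_of_ne (by simp [Fin.ext_iff]; omega)
          (by simp [Fin.ext_iff]; omega), Fin.append_right, Fin.append_right]) s t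

/-- Reindexing of tensor powers as a homomorphism of representations. -/
noncomputable def reindexLieHom (e : Fin n ≃ Fin m) : ⨂[R]^n V →ₗ⁅R,L⁆ ⨂[R]^m V :=
  { (PiTensorProduct.reindex R (fun _ => V) e).toLinearMap with
    map_lie' := by
      intro x t
      change PiTensorProduct.reindex R (fun _ => V) e ⁅x, t⁆ =
        ⁅x, PiTensorProduct.reindex R (fun _ => V) e t⁆
      rw [tensorPower_lie_eq_sum, tensorPower_lie_eq_sum, map_sum, ← e.sum_comp]
      exact Finset.sum_congr rfl fun i _ => reindex_tensorPowerLieAt e x i t }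

theorem tensorConcat_tmul {M N : Type*} [AddCommGroup M] [Module R M] [AddCommGroup N] [Module R N]
    (f : M →ₗ[R] ⨂[R]^n V) (g : N →ₗ[R] ⨂[R]^m V) (a : M) (c : N) :
    tensorConcat f g (a ⊗ₜ[R] c) = concatBilin R V n m (f a) (g c) := rfl

/-- `tensorConcat` of homomorphisms of representations. -/
noncomputable def tensorConcatLieHom {M N : Type*} [AddCommGroup M] [Module R M]
    [AddCommGroup N] [Module R N] [LieRingModule L M] [LieModule R L M] [LieRingModule L N]
    [LieModule R L N] (f : M →ₗ⁅R,L⁆ ⨂[R]^n V) (g : N →ₗ⁅R,L⁆ ⨂[R]^m V) :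
    M ⊗[R] N →ₗ⁅R,L⁆ ⨂[R]^(n + m) V :=
  { tensorConcat (f : M →ₗ[R] ⨂[R]^n V) (g : N →ₗ[R] ⨂[R]^m V) with
    map_lie' := by
      intro x t
      change tensorConcat (f : M →ₗ[R] ⨂[R]^n V) (g : N →ₗ[R] ⨂[R]^m V) ⁅x, t⁆ =
        ⁅x, tensorConcat (f : M →ₗ[R] ⨂[R]^n V) (g : N →ₗ[R] ⨂[R]^m V) t⁆
      induction t using TensorProduct.induction_on with
      | zero => simp
      | tmul a c =>
        rw [TensorProduct.LieModule.lie_tmul_right, map_add, tensorConcat_tmul, tensorConcat_tmul,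
          tensorConcat_tmul, lie_concatBilin]
        simp
      | add s t hs ht => rw [lie_add, map_add, map_add, lie_add, hs, ht] }

end TensorPower

/-! ### The Casimir element acting on pairs of tensor slots. -/

section PairCasimir

variable {L : Type*} [LieRing L] [LieAlgebra ℂ L] [FiniteDimensional ℂ L] [IsKilling ℂ L]
  (H : LieSubalgebra ℂ L) [H.IsCartanSubalgebra]
  {V : Type*} [AddCommGroup V] [Module ℂ V] [LieRingModule L V] [LieModule ℂ L V] {n m : ℕ}

/-- The Casimir element acting on the tensor factors `i` and `j`. -/
noncomputable def pairCasimir (i j : Fin n) : ⨂[ℂ]^n V →ₗ[ℂ] ⨂[ℂ]^n V :=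
  ∑ a, tensorPowerLieAt (killingLeft H a) i ∘ₗ tensorPowerLieAt (killingRight H a) j

theorem pairCasimir_apply (i j : Fin n) (t : ⨂[ℂ]^n V) :
    pairCasimir H i j t =
      ∑ a, tensorPowerLieAt (killingLeft H a) i (tensorPowerLieAt (killingRight H a) j t) := by
  simp [pairCasimir, LinearMap.sum_apply]

theorem pairCasimir_lie (i j : Fin n) (z : L) (t : ⨂[ℂ]^n V) :
    pairCasimir H i j ⁅z, t⁆ = ⁅z, pairCasimir H i j t⁆ := by
  let Φ : L →ₗ[ℂ] L →ₗ[ℂ] ⨂[ℂ]^n V :=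
    LinearMap.mk₂ ℂ (fun x y => tensorPowerLieAt x i (tensorPowerLieAt y j t))
      (by simp [tensorPowerLieAt_add]) (by simp [tensorPowerLieAt_smul])
      (by simp [tensorPowerLieAt_add]) (by simp [tensorPowerLieAt_smul])
  have h := sum_killing_lie_add_eq_zero H Φ z
  rw [pairCasimir_apply, pairCasimir_apply, lie_sum, eq_comm, ← sub_eq_zero,
    ← Finset.sum_sub_distrib, ← h]
  refine Finset.sum_congr rfl fun a _ => ?_
  simp only [Φ, LinearMap.mk₂_apply]
  rw [lie_tensorPowerLieAt, lie_tensorPowerLieAt, map_add]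
  abel

theorem casimir_tensorPower_apply (t : ⨂[ℂ]^n V) :
    casimir H (⨂[ℂ]^n V) t = ∑ i, ∑ j, pairCasimir H i j t := by
  simp only [casimir_apply, pairCasimir_apply, tensorPower_lie_eq_sum, map_sum]
  rw [Finset.sum_comm]
  refine Finset.sum_congr rfl fun i _ => Finset.sum_comm

/-- With both legs in slot i, this is the Casimir operator of V applied to that factor. -/
theorem pairCasimir_self_apply {c : ℂ} (hc : ∀ v : V, casimir H V v = c • v) (i : Fin n)
    (t : ⨂[ℂ]^n V) : pairCasimir H i i t = c • t :=
  linearMap_eq_of_tprod (pairCasimir H i i) (c • LinearMap.id) (fun v => by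
    simp only [pairCasimir_apply, tensorPowerLieAt_tprod, Function.update_self,
      Function.update_idem, LinearMap.smul_apply, LinearMap.id_apply]
    rw [← MultilinearMap.map_update_sum, ← casimir_apply, hc, MultilinearMap.map_update_smul,
      Function.update_eq_self]) t

theorem reindex_pairCasimir (e : Fin n ≃ Fin m) (i j : Fin n) (t : ⨂[ℂ]^n V) :
    PiTensorProduct.reindex ℂ (fun _ => V) e (pairCasimir H i j t) =
      pairCasimir H (e i) (e j) (PiTensorProduct.reindex ℂ (fun _ => V) e t) := by
  simp only [pairCasimir_apply, map_sum, reindex_tensorPowerLieAt]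

theorem concatBilin_pairCasimir_left (i j : Fin n) (s : ⨂[ℂ]^n V) (t : ⨂[ℂ]^m V) :
    pairCasimir H (Fin.castAdd m i) (Fin.castAdd m j) (concatBilin ℂ V n m s t) =
      concatBilin ℂ V n m (pairCasimir H i j s) t := by
  simp only [pairCasimir_apply, map_sum, LinearMap.sum_apply, concatBilin_tensorPowerLieAt_left]

theorem concatBilin_pairCasimir_right (i j : Fin m) (s : ⨂[ℂ]^n V) (t : ⨂[ℂ]^m V) :
    pairCasimir H (Fin.natAdd n i) (Fin.natAdd n j) (concatBilin ℂ V n m s t) =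
      concatBilin ℂ V n m s (pairCasimir H i j t) := by
  simp only [pairCasimir_apply, map_sum, concatBilin_tensorPowerLieAt_right]

end PairCasimir

/-! ### Cartan powers and products, and the intersection formula. -/

section CartanPower

variable {L : Type*} [LieRing L] [LieAlgebra ℂ L] [FiniteDimensional ℂ L] [IsKilling ℂ L]
  {H : LieSubalgebra ℂ L} [H.IsCartanSubalgebra] {b : (rootSystem H).Base}
  {V : Type*} [AddCommGroup V] [Module ℂ V] [LieRingModule L V] [LieModule ℂ L V] {n : ℕ}

omit [FiniteDimensional ℂ L] [IsKilling ℂ L] [H.IsCartanSubalgebra] in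
theorem tprod_mem_weightVectors {μ : Fin n → Module.Dual ℂ H} {v : Fin n → V}
    (hv : ∀ i, v i ∈ weightVectors V (μ i)) :
    (PiTensorProduct.tprod ℂ v : ⨂[ℂ]^n V) ∈ weightVectors (⨂[ℂ]^n V) (∑ i, μ i) := by
  rw [mem_weightVectors]
  intro h
  rw [tensorPower_lie_tprod, LinearMap.sum_apply, Finset.sum_smul]
  refine Finset.sum_congr rfl fun i _ => ?_
  rw [mem_weightVectors.1 (hv i), MultilinearMap.map_update_smul, Function.update_eq_self]

theorem tprod_const_ne_zero {v : V} (hv : v ≠ 0) :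
    (PiTensorProduct.tprod ℂ fun _ : Fin n => v) ≠ 0 := by
  obtain ⟨f, hf⟩ := not_forall.1 (mt (Module.forall_dual_apply_eq_zero_iff ℂ v).1 hv)
  intro h
  have h1 := congrArg (PiTensorProduct.lift
    ((MultilinearMap.mkPiAlgebra ℂ (Fin n) ℂ).compLinearMap fun _ => f)) h
  rw [map_zero, PiTensorProduct.lift.tprod] at h1
  simp at h1
  exact hf h1.1

theorem isHighestWeightVector_tprod {v : V} (hv : IsHighestWeightVector b v) (n : ℕ) :
    IsHighestWeightVector b (PiTensorProduct.tprod ℂ fun _ : Fin n => v) where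
  ne_zero := tprod_const_ne_zero hv.ne_zero
  exists_weight := by
    obtain ⟨μ, hμ⟩ := hv.exists_mem_weightVectors
    exact ⟨_, mem_weightVectors.1 (tprod_mem_weightVectors fun _ : Fin n => hμ)⟩
  lie_eq_zero α hα x hx := by
    rw [tensorPower_lie_tprod]
    refine Finset.sum_eq_zero fun i _ => ?_
    rw [hv.lie_eq_zero α hα x hx]
    exact MultilinearMap.map_update_zero _ _ _

theorem eq_zero_of_sum_mem_positiveCone {ι : Type*} [Fintype ι] {β : ι → Module.Dual ℂ H}
    (hβ : ∀ i, β i ∈ positiveCone b) (h : ∑ i, β i = 0) (i : ι) : β i = 0 := by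
  classical
  rw [← Finset.add_sum_erase Finset.univ β (Finset.mem_univ i)] at h
  exact positiveCone_eq_zero_of_add_eq_zero (hβ i) (sum_mem fun j _ => hβ j) h

theorem tensorPower_eq_span_sup_lowerWeightVectors {μ : Module.Dual ℂ H} {v : V}
    (hμ : v ∈ weightVectors V μ) (hV : ℂ ∙ v ⊔ lowerWeightVectors b V μ = ⊤) (n : ℕ) :
    ℂ ∙ (PiTensorProduct.tprod ℂ fun _ : Fin n => v) ⊔
      lowerWeightVectors b (⨂[ℂ]^n V) (∑ _i : Fin n, μ) = ⊤ := by
  -- A spanning set of weight vectors in which weight μ is represented by v alone. A pure tensor of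
  -- such vectors then has lower weight unless every factor is v.
  let γ : Set V := {u | ∃ β ∈ positiveCone b, u ∈ weightVectors V (μ - β) ∧ (β = 0 → u = v)}
  have hγ : Submodule.span ℂ (Set.range (Subtype.val : γ → V)) = ⊤ := by
    rw [Subtype.range_coe, eq_top_iff, ← hV]
    refine sup_le ?_ (Submodule.span_mono ?_)
    · rw [Submodule.span_singleton_le_iff_mem]
      exact Submodule.subset_span ⟨0, zero_mem _, by simpa using hμ, fun _ => rfl⟩
    · rintro u ⟨_, ⟨β, hβ, hβ0, rfl⟩, hu⟩
      exact ⟨β, hβ, hu, fun h => absurd h hβ0⟩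
  have hspan := PiTensorProduct.submodule_span_eq_top (R := ℂ) (ι := Fin n) (M := fun _ => V)
    (γ := fun _ => γ) (g := fun _ => Subtype.val) (fun _ => hγ)
  rw [eq_top_iff, ← hspan, Submodule.span_le]
  rintro _ ⟨u, rfl⟩
  choose β hβ hu huv using fun i => (u i).2
  have h1 : (PiTensorProduct.tprod ℂ fun i => (u i : V)) ∈
      weightVectors (⨂[ℂ]^n V) (∑ _i : Fin n, μ - ∑ i, β i) := by
    rw [← Finset.sum_sub_distrib]
    exact tprod_mem_weightVectors hu
  by_cases h0 : ∑ i, β i = 0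
  · have h2 : (fun i => (u i : V)) = fun _ => v :=
      funext fun i => huv i (eq_zero_of_sum_mem_positiveCone hβ h0 i)
    refine Submodule.mem_sup_left ?_
    simp only [h2]
    exact Submodule.mem_span_singleton_self _
  · exact Submodule.mem_sup_right
      (mem_lowerWeightVectors_of_mem_weightVectors (sum_mem fun i _ => hβ i) h0 h1)

/-- In each root term one leg is a positive root vector and kills v in its slot; operators in
different slots commute, so it may act first. Only the Cartan part is left, and its scalar is (μ,μ).
-/
theorem pairCasimir_tprod {μ : Module.Dual ℂ H} {v : V} (hv : IsHighestWeightVector b v)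
    (hμ : v ∈ weightVectors V μ) {i j : Fin n} (hij : i ≠ j) :
    pairCasimir H i j (PiTensorProduct.tprod ℂ fun _ => v) =
      (∑ a, μ (cartanDualBasis H a) * μ (cartanBasis H a)) •
        PiTensorProduct.tprod ℂ fun _ => v := by
  rw [pairCasimir_apply, Fintype.sum_sum_type, Finset.sum_smul]
  rw [Finset.sum_eq_zero (s := (Finset.univ : Finset H.root)), add_zero]
  · refine Finset.sum_congr rfl fun a _ => ?_
    rw [killingLeft, killingRight, Sum.elim_inl, Sum.elim_inl, tensorPowerLieAt_tprod,
      mem_weightVectors.1 hμ, MultilinearMap.map_update_smul, map_smul, Function.update_eq_self,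
      tensorPowerLieAt_tprod, mem_weightVectors.1 hμ, MultilinearMap.map_update_smul,
      Function.update_eq_self, smul_smul]
  · intro α _
    rw [killingLeft, killingRight, Sum.elim_inr, Sum.elim_inr]
    have he := rootPair_fst_mem H α.1
    have hf := rootPair_snd_mem H α.1
    rw [LieModule.Weight.coe_neg] at hf
    by_cases hα : b.IsPos α
    · rw [tensorPowerLieAt_comm hij, tensorPowerLieAt_tprod, hv.lie_eq_zero α hα _ he,
        MultilinearMap.map_update_zero, map_zero]
    · let := (rootSystem H).indexNeg
      have hα' := (RootPairing.Base.IsPos.neg_iff_not b α).2 hα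
      rw [tensorPowerLieAt_tprod, hv.lie_eq_zero (-α) hα' _ (by rw [neg_root_coe]; exact hf),
        MultilinearMap.map_update_zero, map_zero]

variable [LieModule.IsIrreducible ℂ L V]

theorem cartanPower_eq_lieSpan {v : V} (hv : IsHighestWeightVector b v) (n : ℕ) :
    cartanPower b V n = LieSubmodule.lieSpan ℂ L {PiTensorProduct.tprod ℂ fun _ : Fin n => v} := by
  refine le_antisymm (LieSubmodule.lieSpan_le.2 ?_) (LieSubmodule.lieSpan_mono ?_)
  · rintro _ ⟨w, hw, rfl⟩
    obtain ⟨c, -, rfl⟩ := exists_smul_eq_of_isHighestWeightVector hv hw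
    rw [MultilinearMap.map_smul_univ _ (fun _ => c) (fun _ => v)]
    exact SMulMemClass.smul_mem _ (LieSubmodule.subset_lieSpan rfl)
  · rintro _ rfl
    exact ⟨v, hv, rfl⟩

theorem cartanProduct_eq_lieSpan {M N : Type*}
    [AddCommGroup M] [Module ℂ M] [LieRingModule L M] [LieModule ℂ L M]
    [AddCommGroup N] [Module ℂ N] [LieRingModule L N] [LieModule ℂ L N]
    [LieModule.IsIrreducible ℂ L M] [LieModule.IsIrreducible ℂ L N] {v : M} {w : N}
    (hv : IsHighestWeightVector b v) (hw : IsHighestWeightVector b w) :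
    cartanProduct b M N = LieSubmodule.lieSpan ℂ L {v ⊗ₜ[ℂ] w} := by
  refine le_antisymm (LieSubmodule.lieSpan_le.2 ?_) (LieSubmodule.lieSpan_mono ?_)
  · rintro _ ⟨v', w', hv', hw', rfl⟩
    obtain ⟨c, -, rfl⟩ := exists_smul_eq_of_isHighestWeightVector hv hv'
    obtain ⟨d, -, rfl⟩ := exists_smul_eq_of_isHighestWeightVector hw hw'
    rw [TensorProduct.smul_tmul_smul]
    exact SMulMemClass.smul_mem _ (LieSubmodule.subset_lieSpan rfl)
  · rintro _ rfl
    exact ⟨v, w, hv, hw, rfl⟩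

omit [LieAlgebra ℂ L] [FiniteDimensional ℂ L] [IsKilling ℂ L] in
theorem map_lieSpan_singleton {M N : Type*}
    [AddCommGroup M] [Module ℂ M] [LieRingModule L M]
    [AddCommGroup N] [Module ℂ N] [LieRingModule L N]
    (f : M →ₗ⁅ℂ,L⁆ N) (v : M) :
    (LieSubmodule.lieSpan ℂ L {v}).map f = LieSubmodule.lieSpan ℂ L {f v} := by
  refine le_antisymm ?_ (LieSubmodule.lieSpan_le.2 ?_)
  · rw [LieSubmodule.map_le_iff_le_comap, LieSubmodule.lieSpan_le,
      Set.singleton_subset_iff]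
    exact LieSubmodule.subset_lieSpan (s := {f v}) rfl
  · rw [Set.singleton_subset_iff]
    exact LieSubmodule.mem_map_of_mem (LieSubmodule.subset_lieSpan rfl)

variable (V) [FiniteDimensional ℂ V]

theorem exists_isHighestWeightVector_span_sup_eq_top (b : (rootSystem H).Base) : ∃ v : V, IsHighestWeightVector b v ∧
    ∃ μ : Module.Dual ℂ H, v ∈ weightVectors V μ ∧ ℂ ∙ v ⊔ lowerWeightVectors b V μ = ⊤ ∧
      ∀ u : V, casimir H V u = casimirEigenvalue b μ • u := by
  have := LieModule.nontrivial_of_isIrreducible ℂ L V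
  obtain ⟨v, hv⟩ := exists_isHighestWeightVector (M := V) b
  obtain ⟨μ, hμ⟩ := hv.exists_mem_weightVectors
  have htop : LieSubmodule.lieSpan ℂ L {v} = ⊤ :=
    (IsSimpleOrder.eq_bot_or_eq_top _).resolve_left fun h => hv.ne_zero (by
      have h1 : v ∈ LieSubmodule.lieSpan ℂ L {v} := LieSubmodule.subset_lieSpan rfl
      rw [h] at h1
      simpa using h1)
  refine ⟨v, hv, μ, hμ, ?_, fun u => ?_⟩
  · have h1 := lieSpan_le_of_isHighestWeightVector hv hμ
    rwa [htop, LieSubmodule.top_toSubmodule, top_le_iff] at h1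
  · exact casimir_apply_of_mem_lieSpan (casimir_apply_of_isHighestWeightVector hv hμ)
      (htop ▸ LieSubmodule.mem_top u)

theorem isIrreducibleSummand_cartanPower (b : (rootSystem H).Base) (n : ℕ) :
    IsIrreducibleSummand (cartanPower b V n) := by
  obtain ⟨v, hv, μ, hμ, hV, -⟩ := exists_isHighestWeightVector_span_sup_eq_top V b
  rw [cartanPower_eq_lieSpan hv]
  exact (isIrreducibleSummand_lieSpan (isHighestWeightVector_tprod hv n)
    (tprod_mem_weightVectors fun _ => hμ) (tensorPower_eq_span_sup_lowerWeightVectors hμ hV n)).1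

/-- The Cartan power is the common eigenspace of the Casimir elements acting on pairs of tensor
factors. -/
theorem exists_mem_cartanPower_iff (b : (rootSystem H).Base) : ∃ κ : ℂ, ∀ (n : ℕ) (t : ⨂[ℂ]^n V),
    t ∈ cartanPower b V n ↔ ∀ i j : Fin n, i ≠ j → pairCasimir H i j t = κ • t := by
  obtain ⟨v, hv, μ, hμ, hV, hcas⟩ := exists_isHighestWeightVector_span_sup_eq_top V b
  -- The scalar does not depend on n, so eigenvalue equations for p+q, q+r and p+q+r slots can be
  -- compared.
  refine ⟨∑ a, μ (cartanDualBasis H a) * μ (cartanBasis H a), fun n t => ?_⟩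
  set κ := ∑ a, μ (cartanDualBasis H a) * μ (cartanBasis H a)
  have hpair := fun i j hij => pairCasimir_tprod (n := n) hv hμ (i := i) (j := j) hij
  rw [cartanPower_eq_lieSpan hv]
  constructor
  · intro ht i j hij
    let E : LieSubmodule ℂ L (⨂[ℂ]^n V) :=
      { LinearMap.ker (pairCasimir H i j - κ • LinearMap.id : ⨂[ℂ]^n V →ₗ[ℂ] ⨂[ℂ]^n V) with
        lie_mem := by
          intro x u hu
          simp only [AddSubsemigroup.mem_carrier, AddSubmonoid.mem_toSubsemigroup,
            Submodule.mem_toAddSubmonoid, LinearMap.mem_ker, LinearMap.sub_apply,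
            LinearMap.smul_apply, LinearMap.id_apply] at hu ⊢
          rw [pairCasimir_lie, ← lie_smul, ← lie_sub, hu, lie_zero] }
    have hE : ∀ u, u ∈ E ↔ pairCasimir H i j u = κ • u := fun u => by
      rw [← sub_eq_zero]
      rfl
    exact (hE t).1 (LieSubmodule.lieSpan_le.2
      (Set.singleton_subset_iff.2 ((hE _).2 (hpair i j hij))) ht)
  · intro ht
    have key : ∀ u : ⨂[ℂ]^n V, (∀ i j : Fin n, i ≠ j → pairCasimir H i j u = κ • u) →
        casimir H (⨂[ℂ]^n V) u =
          (∑ i : Fin n, ∑ j : Fin n, if i = j then casimirEigenvalue b μ else κ) • u :=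
      fun u hu => by
        rw [casimir_tensorPower_apply, Finset.sum_smul]
        refine Finset.sum_congr rfl fun i _ => ?_
        rw [Finset.sum_smul]
        refine Finset.sum_congr rfl fun j _ => ?_
        split_ifs with hij
        · subst hij
          exact pairCasimir_self_apply H hcas i u
        · exact hu i j hij
    have hhw := isHighestWeightVector_tprod hv n
    have hwt : (PiTensorProduct.tprod ℂ fun _ : Fin n => v) ∈ weightVectors (⨂[ℂ]^n V)
        (∑ _i : Fin n, μ) := tprod_mem_weightVectors fun _ => hμ
    refine (isIrreducibleSummand_lieSpan hhw hwt
      (tensorPower_eq_span_sup_lowerWeightVectors hμ hV n)).2 t ?_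
    rw [key t ht]
    congr 1
    -- The total scalar is identified by evaluating on v ⊗ ⋯ ⊗ v, which satisfies the same pair
    -- equations.
    exact smul_left_injective ℂ hhw.ne_zero
      ((key _ hpair).symm.trans (casimir_apply_of_isHighestWeightVector hhw hwt))

-- Permuting slots commutes with L, so the fixed tensors form a subrepresentation, and it contains
-- the generators v ⊗ ⋯ ⊗ v.
omit [LieModule.IsIrreducible ℂ L V] [FiniteDimensional ℂ V] in
theorem reindex_eq_self_of_mem_cartanPower {σ : Equiv.Perm (Fin n)} {t : ⨂[ℂ]^n V}
    (ht : t ∈ cartanPower b V n) : PiTensorProduct.reindex ℂ (fun _ => V) σ t = t := by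
  let E : LieSubmodule ℂ L (⨂[ℂ]^n V) :=
    { LinearMap.ker (((reindexLieHom σ : ⨂[ℂ]^n V →ₗ⁅ℂ,L⁆ ⨂[ℂ]^n V) : ⨂[ℂ]^n V →ₗ[ℂ] ⨂[ℂ]^n V) -
        LinearMap.id) with
      lie_mem := by
        intro x u hu
        simp only [AddSubsemigroup.mem_carrier, AddSubmonoid.mem_toSubsemigroup,
          Submodule.mem_toAddSubmonoid, LinearMap.mem_ker, LinearMap.sub_apply,
          LinearMap.id_apply, LieModuleHom.coe_toLinearMap] at hu ⊢
        rw [LieModuleHom.map_lie, ← lie_sub, hu, lie_zero] }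
  have hE : ∀ u, u ∈ E ↔ PiTensorProduct.reindex ℂ (fun _ => V) σ u = u := fun u => by
    rw [← sub_eq_zero]
    rfl
  refine (hE t).1 (LieSubmodule.lieSpan_le.2 ?_ ht)
  rintro _ ⟨v, -, rfl⟩
  refine (hE _).2 ?_
  rw [PiTensorProduct.reindex_tprod]

/-- The map `(⊚^p V) ⊗ (⊚^q V) → ⨂^(p + q) V`. -/
noncomputable def cartanPowerConcat (b : (rootSystem H).Base) (p q : ℕ) :
    cartanPower b V p ⊗[ℂ] cartanPower b V q →ₗ⁅ℂ,L⁆ ⨂[ℂ]^(p + q) V :=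
  tensorConcatLieHom (cartanPower b V p).incl (cartanPower b V q).incl

omit [LieModule.IsIrreducible ℂ L V] [FiniteDimensional ℂ V] in
theorem cartanPowerConcat_injective (p q : ℕ) :
    Function.Injective (cartanPowerConcat V b p q) := by
  have h : Function.Injective (TensorProduct.map
      ((cartanPower b V p).incl : cartanPower b V p →ₗ[ℂ] ⨂[ℂ]^p V)
      ((cartanPower b V q).incl : cartanPower b V q →ₗ[ℂ] ⨂[ℂ]^q V)) := by
    rw [← LinearMap.lTensor_comp_rTensor, LinearMap.coe_comp]
    exact (Module.Flat.lTensor_preserves_injective_linearMap _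
      (cartanPower b V q).injective_incl).comp
      (Module.Flat.rTensor_preserves_injective_linearMap _ (cartanPower b V p).injective_incl)
  exact TensorPower.mulEquiv.injective.comp h

/-- Concatenation is equivariant and sends the generator of the Cartan product to v ⊗ ⋯ ⊗ v with p+q
factors. -/
theorem map_cartanProduct (p q : ℕ) :
    (cartanProduct b (cartanPower b V p) (cartanPower b V q)).map (cartanPowerConcat V b p q) =
      cartanPower b V (p + q) := by
  obtain ⟨v, hv, -⟩ := exists_isHighestWeightVector_span_sup_eq_top V b
  have := (isIrreducibleSummand_cartanPower V b p).1
  have := (isIrreducibleSummand_cartanPower V b q).1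
  have hmem : ∀ n, (PiTensorProduct.tprod ℂ fun _ : Fin n => v) ∈ cartanPower b V n :=
    fun n => LieSubmodule.subset_lieSpan ⟨v, hv, rfl⟩
  have hhw : ∀ n, IsHighestWeightVector b (⟨_, hmem n⟩ : cartanPower b V n) := fun n =>
    IsHighestWeightVector.of_map (cartanPower b V n).incl (cartanPower b V n).injective_incl
      (isHighestWeightVector_tprod hv n)
  rw [cartanProduct_eq_lieSpan (hhw p) (hhw q), map_lieSpan_singleton,
    cartanPower_eq_lieSpan hv (p + q)]
  congr 2
  refine (concatBilin_tprod (R := ℂ) (fun _ : Fin p => v) (fun _ : Fin q => v)).trans ?_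
  congr 1
  ext k
  refine Fin.addCases (fun k => ?_) (fun k => ?_) k <;> simp

theorem isIrreducibleSummand_cartanProduct (b : (rootSystem H).Base) (p q : ℕ) :
    IsIrreducibleSummand (cartanProduct b (cartanPower b V p) (cartanPower b V q)) :=
  isIrreducibleSummand_of_map (cartanPowerConcat V b p q) (cartanPowerConcat_injective V p q)
    (by rw [map_cartanProduct]; exact isIrreducibleSummand_cartanPower V b (p + q))

theorem cartanProductIncl_mem (p q : ℕ)
    (a : cartanProduct b (cartanPower b V p) (cartanPower b V q)) :
    cartanProductIncl b V p q a ∈ cartanPower b V (p + q) := by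
  rw [← map_cartanProduct]
  exact LieSubmodule.mem_map_of_mem (f := cartanPowerConcat V b p q) a.2

theorem exists_cartanProductIncl_eq {p q : ℕ} {t : ⨂[ℂ]^(p + q) V}
    (ht : t ∈ cartanPower b V (p + q)) : ∃ a, cartanProductIncl b V p q a = t := by
  rw [← map_cartanProduct] at ht
  obtain ⟨a, ha, rfl⟩ := (LieSubmodule.mem_map _).1 ht
  exact ⟨⟨a, ha⟩, rfl⟩

omit [FiniteDimensional ℂ V] in
theorem concat_induction {M N : Type*} [AddCommGroup M] [Module ℂ M] [AddCommGroup N] [Module ℂ N]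
    {p q : ℕ} (f : M →ₗ[ℂ] ⨂[ℂ]^p V) (g : N →ₗ[ℂ] ⨂[ℂ]^q V)
    (F G : ⨂[ℂ]^(p + q) V →ₗ[ℂ] ⨂[ℂ]^(p + q) V)
    (h : ∀ a c, F (concatBilin ℂ V p q (f a) (g c)) = G (concatBilin ℂ V p q (f a) (g c)))
    (t : M ⊗[ℂ] N) : F (tensorConcat f g t) = G (tensorConcat f g t) := by
  induction t using TensorProduct.induction_on with
  | zero => simp
  | tmul a c => exact h a c
  | add s t hs ht => rw [map_add, map_add, map_add, hs, ht]

theorem cartanPower_le_leftCartanTensor (b : (rootSystem H).Base) (p q r : ℕ) :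
    (cartanPower b V (p + q + r)).toSubmodule ≤ leftCartanTensor b V p q r := by
  intro t ht
  obtain ⟨a, rfl⟩ := exists_cartanProductIncl_eq V ht
  have hle : ∀ s : cartanPower b V (p + q) ⊗[ℂ] cartanPower b V r,
      cartanPowerConcat V b (p + q) r s ∈ leftCartanTensor b V p q r := fun s => by
    induction s using TensorProduct.induction_on with
    | zero => rw [map_zero]; exact zero_mem _
    | tmul x y =>
      obtain ⟨z, hz⟩ := exists_cartanProductIncl_eq V x.2
      refine ⟨z ⊗ₜ y, ?_⟩
      rw [tensorConcat_tmul, hz]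
      rfl
    | add x y hx hy => rw [map_add]; exact add_mem hx hy
  exact hle a.1

omit [LieModule.IsIrreducible ℂ L V] [FiniteDimensional ℂ V] in
theorem cast_mem_cartanPower {m : ℕ} (h : n = m) {t : ⨂[ℂ]^n V} (ht : t ∈ cartanPower b V n) :
    TensorPower.cast ℂ V h t ∈ cartanPower b V m := by
  subst h
  simpa using ht

theorem cartanPower_le_rightCartanTensor (b : (rootSystem H).Base) (p q r : ℕ) :
    (cartanPower b V (p + q + r)).toSubmodule ≤ rightCartanTensor b V p q r := by
  intro t ht
  obtain ⟨a, ha⟩ := exists_cartanProductIncl_eq V (cast_mem_cartanPower V (add_assoc p q r) ht)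
  have hle : ∀ s : cartanPower b V p ⊗[ℂ] cartanPower b V (q + r),
      cartanPowerConcat V b p (q + r) s ∈ LinearMap.range
        (tensorConcat (cartanPowerIncl b V p) (cartanProductIncl b V q r)) := fun s => by
    induction s using TensorProduct.induction_on with
    | zero => rw [map_zero]; exact zero_mem _
    | tmul x y =>
      obtain ⟨z, hz⟩ := exists_cartanProductIncl_eq V y.2
      refine ⟨x ⊗ₜ z, ?_⟩
      rw [tensorConcat_tmul, hz]
      rfl
    | add x y hx hy => rw [map_add]; exact add_mem hx hy
  obtain ⟨s, hs⟩ := hle a.1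
  refine ⟨s, ?_⟩
  have ha' : cartanPowerConcat V b p (q + r) a.1 = TensorPower.cast ℂ V (add_assoc p q r) t := ha
  rw [LinearMap.comp_apply, hs, ha', LinearEquiv.coe_coe, TensorPower.cast_cast]
  simp

theorem leftCartanTensor_inf_rightCartanTensor (b : (rootSystem H).Base) (p q r : ℕ) (hq : 0 < q) :
    leftCartanTensor b V p q r ⊓ rightCartanTensor b V p q r =
      (cartanPower b V (p + q + r)).toSubmodule := by
  refine le_antisymm ?_ (le_inf (cartanPower_le_leftCartanTensor V b p q r)
    (cartanPower_le_rightCartanTensor V b p q r))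
  obtain ⟨κ, hκ⟩ := exists_mem_cartanPower_iff V b
  rintro t ⟨⟨s, hs⟩, ⟨s', hs'⟩⟩
  have hleft : ∀ i j : Fin (p + q), i ≠ j →
      pairCasimir H (Fin.castAdd r i) (Fin.castAdd r j) t = κ • t := fun i j hij => by
    rw [← hs]
    refine concat_induction V _ _ (pairCasimir H (Fin.castAdd r i) (Fin.castAdd r j))
      (κ • LinearMap.id) (fun a c => ?_) s
    rw [concatBilin_pairCasimir_left, (hκ _ _).1 (cartanProductIncl_mem V p q a) i j hij, map_smul]
    rfl
  -- The left factor lies in a Cartan power, so it consists of symmetric tensors.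
  have hswap : ∀ i j : Fin (p + q), PiTensorProduct.reindex ℂ (fun _ => V)
      (Equiv.swap (Fin.castAdd r i) (Fin.castAdd r j)) t = t := fun i j => by
    rw [← hs]
    refine concat_induction V _ _ (PiTensorProduct.reindex ℂ (fun _ => V)
      (Equiv.swap (Fin.castAdd r i) (Fin.castAdd r j))).toLinearMap LinearMap.id (fun a c => ?_) s
    rw [LinearEquiv.coe_coe, reindex_swap_concatBilin,
      reindex_eq_self_of_mem_cartanPower V (cartanProductIncl_mem V p q a)]
    rfl
  have hright' : ∀ i j : Fin (q + r), i ≠ j →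
      pairCasimir H (finCongr (add_assoc p q r).symm (Fin.natAdd p i))
        (finCongr (add_assoc p q r).symm (Fin.natAdd p j)) t = κ • t := fun i j hij => by
    rw [← hs', LinearMap.comp_apply, LinearEquiv.coe_coe, TensorPower.cast, ← reindex_pairCasimir,
      ← map_smul]
    congr 1
    refine concat_induction V _ _ (pairCasimir H (Fin.natAdd p i) (Fin.natAdd p j))
      (κ • LinearMap.id) (fun a c => ?_) s'
    rw [concatBilin_pairCasimir_right, (hκ _ _).1 (cartanProductIncl_mem V q r c) i j hij, map_smul]
    rfl
  have hright : ∀ i j : Fin (p + q + r), p ≤ (i : ℕ) → p ≤ (j : ℕ) → i ≠ j →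
      pairCasimir H i j t = κ • t := fun i j hi hj hij => by
    have h := hright' ⟨i - p, by omega⟩ ⟨j - p, by omega⟩ (by
      intro h
      apply hij
      rw [Fin.ext_iff] at h ⊢
      simp only at h
      omega)
    convert h using 3 <;> (rw [Fin.ext_iff]; simp; omega)
  have hleft' : ∀ i j : Fin (p + q + r), (i : ℕ) < p + q → (j : ℕ) < p + q → i ≠ j →
      pairCasimir H i j t = κ • t := fun i j hi hj hij =>
    hleft ⟨i, hi⟩ ⟨j, hj⟩ (fun h => hij (by
      rw [Fin.ext_iff] at h ⊢
      exact h))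
  -- Conjugation by a transposition that fixes t carries an eigenvalue equation from one pair of
  -- slots to the transposed pair.
  have hconj : ∀ i k : Fin (p + q + r), (i : ℕ) < p + q → (k : ℕ) < p + q →
      ∀ i' j' : Fin (p + q + r), pairCasimir H i' j' t = κ • t →
        pairCasimir H (Equiv.swap i k i') (Equiv.swap i k j') t = κ • t :=
    fun i k hi hk i' j' h => by
      have hs : PiTensorProduct.reindex ℂ (fun _ => V) (Equiv.swap i k) t = t :=
        hswap ⟨i, hi⟩ ⟨k, hk⟩
      have h1 := reindex_pairCasimir H (Equiv.swap i k) i' j' t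
      rw [h, map_smul, hs] at h1
      exact h1.symm
  refine (hκ _ t).2 fun i j hij => ?_
  -- The first middle slot (indices start at 0). It lies in both overlapping ranges because q > 0.
  let k : Fin (p + q + r) := ⟨p, by omega⟩
  by_cases hi : (i : ℕ) < p
  · by_cases hj : (j : ℕ) < p + q
    · exact hleft' i j (by omega) hj hij
    · have hkj : k ≠ j := by rw [ne_eq, Fin.ext_iff]; simp only [k]; omega
      have h := hconj i k (by omega) (by simp only [k]; omega) k j
        (hright k j le_rfl (by omega) hkj)
      rwa [Equiv.swap_apply_right, Equiv.swap_apply_of_ne_of_ne hij.symm hkj.symm] at h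
  · by_cases hj : (j : ℕ) < p
    · by_cases hi' : (i : ℕ) < p + q
      · exact hleft' i j hi' (by omega) hij
      · have hki : k ≠ i := by rw [ne_eq, Fin.ext_iff]; simp only [k]; omega
        have h := hconj j k (by omega) (by simp only [k]; omega) i k
          (hright i k (by omega) le_rfl hki.symm)
        rwa [Equiv.swap_apply_right, Equiv.swap_apply_of_ne_of_ne hij hki.symm] at h
    · exact hright i j (by omega) (by omega) hij

end CartanPower

theorem mainTheorem11
    {L : Type*} [LieRing L] [LieAlgebra ℂ L] [FiniteDimensional ℂ L] [LieAlgebra.IsSemisimple ℂ L]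
    {H : LieSubalgebra ℂ L} [H.IsCartanSubalgebra] (b : (rootSystem H).Base)
    (V : Type*) [AddCommGroup V] [Module ℂ V] [LieRingModule L V] [LieModule ℂ L V]
    [FiniteDimensional ℂ V] [LieModule.IsIrreducible ℂ L V] :
    (∀ k : ℕ, 0 < k → IsIrreducibleSummand (cartanPower b V k)) ∧
    (∀ p q : ℕ, 0 < p → 0 < q →
      IsIrreducibleSummand (cartanProduct b (cartanPower b V p) (cartanPower b V q))) ∧
    (∀ p q r : ℕ, 0 < p → 0 < q → 0 < r →
      leftCartanTensor b V p q r ⊓ rightCartanTensor b V p q r =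
        (cartanPower b V (p + q + r)).toSubmodule) :=
  ⟨fun k _ => isIrreducibleSummand_cartanPower V b k,
    fun p q _ _ => isIrreducibleSummand_cartanProduct V b p q,
    fun p q r _ hq _ => leftCartanTensor_inf_rightCartanTensor V b p q r hq⟩
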